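/- Let $\mathcal O$ be a commutative ring and let $G=\operatorname{Spec} H$ be a generalised torus over $\mathcal O$, i.e. a smooth affine $\mathcal O$-group scheme whose neutral component $G^0$ (the subgroup of points lying fibrewise in the identity component) is a torus, that is, fpqc-locally on $\operatorname{Spec}\mathcal O$ isomorphic to some $\mathbb G_m^n$, and whose component group $G/G^0$ (fpqc quotient) is finite over $\mathcal O$. Let $\Gamma$ be an abstract group. For an $\mathcal O$-algebra $A$ let $\mathrm{Rep}^{\Gamma}_G(A)$ be the set of homomorphisms $\rho:\Gamma\to G(A)$. Let $G^0$ act on $G^n$ by simultaneous conjugation. Let $\mathrm{PC}^{\Gamma}_G(A)$ be the set of $A$-valued $G$-pseudocharacters of $\Gamma$, i.e. of sequences $(\Theta_n)_{n\ge 1}$ of $\mathcal O$-algebra homomorphisms $\Theta_n:\mathcal O[G^n]^{G^0}\to \mathrm{Map}(\Gamma^n,A)$ such that (1) $\Theta_n(f^{\zeta})(\gamma_1,\dots,\gamma_n)=\Theta_m(f)(\gamma_{\zeta(1)},\dots,\gamma_{\zeta(m)})$ for all $m,n\ge 1$, all maps $\zeta:\{1,\dots,m\}\to\{1,\dots,n\}$,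 all $f\in\mathcal O[G^m]^{G^0}$ and $\gamma_i\in\Gamma$, where $f^{\zeta}(g_1,\dots,g_n)=f(g_{\zeta(1)},\dots,g_{\zeta(m)})$; (2) $\Theta_{n+1}(\hat f)(\gamma_1,\dots,\gamma_{n+1})=\Theta_n(f)(\gamma_1,\dots,\gamma_{n-1},\gamma_n\gamma_{n+1})$ for all $n\ge 1$, $f\in\mathcal O[G^n]^{G^0}$ and $\gamma_i\in\Gamma$, where $\hat f(g_1,\dots,g_{n+1})=f(g_1,\dots,g_{n-1},g_ng_{n+1})$. The pseudocharacter $\Theta_\rho$ of $\rho\in\mathrm{Rep}^{\Gamma}_G(A)$ is given by $(\Theta_\rho)_n(f)(\gamma_1,\dots,\gamma_n)=f(\rho(\gamma_1),\dots,\rho(\gamma_n))$. (a) The functors $\mathrm{Rep}^{\Gamma}_G$ and $\mathrm{PC}^{\Gamma}_G$ are representable by affine $\mathcal O$-schemes, and $\rho\mapsto\Theta_\rho$ induces an isomorphism $\mathrm{Rep}^{\Gamma}_G/\!\!/G^0\xrightarrow{\ \cong\ }\mathrm{PC}^{\Gamma}_G$; that is, the induced map of $\mathcal O$-algebras $\mathcal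 O(\mathrm{PC}^{\Gamma}_G)\to\mathcal O(\mathrm{Rep}^{\Gamma}_G)$ is an isomorphism onto the ring of invariants $\mathcal O(\mathrm{Rep}^{\Gamma}_G)^{G^0}$ of the conjugation action. (b) Suppose moreover that $G/G^0$ is the constant group scheme $\underline\Delta$ of a finite group $\Delta$, with quotient map $\Pi:G\to\underline\Delta$, and let $\pi:\Gamma\to\Delta$ be a homomorphism. Call $\rho\in\mathrm{Rep}^{\Gamma}_G(A)$ admissible if $\Pi\circ\rho$ is the composite of $\pi$ with $\Delta\to\underline\Delta(A)$, and call $\Theta\in\mathrm{PC}^{\Gamma}_G(A)$ admissible if its image in $\mathrm{PC}^{\Gamma}_{\underline\Delta}(A)$ under $\Pi$ is the $\underline\Delta$-pseudocharacter attached to $\pi$. The functors $\mathrm{Rep}^{\Gamma}_{G,\pi}$ and $\mathrm{PC}^{\Gamma}_{G,\pi}$ of admissible representations and admissible pseudocharacters are representable by affine $\mathcal O$-schemes, and $\rho\mapsto\Theta_\rho$ induces an isomorphism $\mathrm{Rep}^{\Gamma}_{G,\pi}/\!\!/G^0\xrightarrow{\ \cong\ }\mathrm{PC}^{\Gamma}_{G,\pi}$,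 i.e. an isomorphism $\mathcal O(\mathrm{PC}^{\Gamma}_{G,\pi})\cong\mathcal O(\mathrm{Rep}^{\Gamma}_{G,\pi})^{G^0}$. -/

import Mathlib

open scoped TensorProduct
open WithConv

universe u

namespace GenTorus

noncomputable section

/-! ### Affine group schemes: the group scheme `G = Spec H` is given by its Hopf algebra `H` -/

/-- The group `G(A)` of `A`-points of `G = Spec H` (with the convolution product). -/
abbrev Pt (O H A : Type*) [CommRing O] [CommRing H] [HopfAlgebra O H] [CommRing A] [Algebra O A] :=
  WithConv (H →ₐ[O] A)

section Points

variable {O H H' A B : Type*} [CommRing O] [CommRing H] [HopfAlgebra O H]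
  [CommRing H'] [HopfAlgebra O H'] [CommRing A] [Algebra O A] [CommRing B] [Algebra O B]

instance instGroupPt : Group (Pt O H A) where
  inv f := toConv (f.ofConv.comp (HopfAlgebra.antipodeAlgHom O H))
  inv_mul_cancel f := by
    have h := AlgHom.comp_convMul_distrib f.ofConv
      (toConv (HopfAlgebra.antipodeAlgHom O H)) (toConv (AlgHom.id O H))
    rw [AlgHom.antipode_id_cancel] at h
    apply WithConv.ext
    refine h.symm.trans ?_
    ext x
    simp

/-- The map `G(A) → G(B)` induced by a morphism `A → B`. -/
def Pt.map (φ : A →ₐ[O] B) : Pt O H A →* Pt O H B where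
  toFun g := toConv (φ.comp g.ofConv)
  map_one' := by ext x; simp
  map_mul' f g := WithConv.ext (AlgHom.comp_convMul_distrib φ f g)

/-- The map `G(A) → G'(A)` induced by a morphism of group schemes `G = Spec H → G' = Spec H'`. -/
def Pt.push (p : H' →ₐc[O] H) : Pt O H A →* Pt O H' A where
  toFun g := toConv (g.ofConv.comp (p : H' →ₐ[O] H))
  map_one' := by
    ext x
    simp
  map_mul' f g := WithConv.ext (AlgHom.convMul_comp_bialgHom_distrib f g p)

end Points

/-! ### The neutral component -/

section Neutral

variable (O H : Type u) [CommRing O] [CommRing H] [HopfAlgebra O H]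

/-- The set of points `x` of `G` lying in the connected component of the identity of the fibre of
`G → Spec O` through `x`. -/
def neutralLocus : Set (PrimeSpectrum H) :=
  {x | x ∈ connectedComponentIn
    (PrimeSpectrum.comap (algebraMap O H) ⁻¹' {PrimeSpectrum.comap (algebraMap O H) x})
    (PrimeSpectrum.comap (Bialgebra.counitAlgHom O H).toRingHom
      (PrimeSpectrum.comap (algebraMap O H) x))}

variable {O H} in
/-- `G⁰(A)`: the points `Spec A → G` whose image lies in the neutral locus. -/
def neutralPt (A : Type u) [CommRing A] [Algebra O A] : Set (Pt O H A) :=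
  {g | ∀ t : PrimeSpectrum A, PrimeSpectrum.comap g.ofConv.toRingHom t ∈ neutralLocus O H}

end Neutral

/-! ### Generalised tori -/

section Torus

variable (O : Type u) [CommRing O]

/-- `Spec T` is a torus over `O`: it becomes isomorphic to `𝔾ₘⁿ` (`n` locally constant), as a group
scheme, over an fpqc covering of `Spec O`. -/
def IsTorus (T : Type u) [CommRing T] [HopfAlgebra O T] : Prop :=
  ∃ (k : ℕ) (O' : Fin k → Type u) (_ : ∀ i, CommRing (O' i)) (_ : ∀ i, Algebra O (O' i))
    (n : Fin k → ℕ),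
    (∀ i, Module.Flat O (O' i)) ∧
    (∀ s : PrimeSpectrum O, ∃ i, s ∈ Set.range (PrimeSpectrum.comap (algebraMap O (O' i)))) ∧
    ∀ i, Nonempty (O' i ⊗[O] T ≃ₐc[O' i] AddMonoidAlgebra (O' i) (Fin (n i) → ℤ))

variable {O}

/-- The morphism `G → Spec B` given by `ι` exhibits `Spec B` as the fpqc quotient `G/G⁰`: it is
faithfully flat, and two points of `G` have the same image exactly if they differ by `G⁰`. -/
def IsComponentQuotient {H B : Type u} [CommRing H] [HopfAlgebra O H] [CommRing B] [Algebra O B]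
    (ι : B →ₐ[O] H) : Prop :=
  ι.toRingHom.FaithfullyFlat ∧
  ∀ (A : Type u) [CommRing A] [Algebra O A] (g g' : Pt O H A),
    g.ofConv.comp ι = g'.ofConv.comp ι ↔ g⁻¹ * g' ∈ neutralPt A

variable (O)

/-- `G = Spec H` is a generalised torus: a smooth affine group scheme such that the neutral
component `G⁰` is a torus and the component group `G/G⁰` is finite (it is then finite étale). -/
structure IsGeneralisedTorus (H : Type u) [CommRing H] [HopfAlgebra O H] : Prop where
  smooth : Algebra.Smooth O H
  torus : ∃ (T : Type u) (_ : CommRing T) (_ : HopfAlgebra O T) (q : H →ₐc[O] T), IsTorus O T ∧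
    ∀ (A : Type u) [CommRing A] [Algebra O A],
      Function.Injective (Pt.push q : Pt O T A →* Pt O H A) ∧
      Set.range (Pt.push q : Pt O T A →* Pt O H A) = neutralPt A
  finite_quotient : ∃ (B : Type u) (_ : CommRing B) (_ : Algebra O B) (ι : B →ₐ[O] H),
    Module.Finite O B ∧ IsComponentQuotient ι

end Torus

/-! ### Functions on `Gⁿ` and their `G⁰`-invariants -/

section Functions

variable (O H : Type u) [CommRing O] [CommRing H] [HopfAlgebra O H]

/-- The coordinate ring `𝒪[Gⁿ]`. -/
abbrev Coord (n : ℕ) : Type u := ⨂[O] (_ : Fin n), H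

variable {O H} {A B : Type u} [CommRing A] [Algebra O A] [CommRing B] [Algebra O B]

/-- `evalAt g f = f(g₁, …, gₙ)` for `f ∈ 𝒪[Gⁿ]` and `g₁, …, gₙ ∈ G(A)`. -/
def evalAt {n : ℕ} (g : Fin n → Pt O H A) : Coord O H n →ₐ[O] A :=
  PiTensorProduct.liftAlgHom
    ((MultilinearMap.mkPiAlgebra O (Fin n) A).compLinearMap fun i => (g i).ofConv.toLinearMap)
    (by simp) (fun x y => by simp [Finset.prod_mul_distrib])

/-- The `i`-th coordinate on `Gⁿ`, as a point of `G` with values in `𝒪[Gⁿ]`. -/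
def coordPt {n : ℕ} (i : Fin n) : Pt O H (Coord O H n) :=
  toConv (PiTensorProduct.singleAlgHom (R := O) (A := fun _ : Fin n => H) i)

lemma evalAt_single {n : ℕ} (g : Fin n → Pt O H A) (i : Fin n) :
    (evalAt g).comp (PiTensorProduct.singleAlgHom (R := O) (A := fun _ : Fin n => H) i) =
      (g i).ofConv := by
  ext x
  refine (PiTensorProduct.lift.tprod _).trans ?_
  simp only [MultilinearMap.compLinearMap_apply, MultilinearMap.mkPiAlgebra_apply]
  rw [Finset.prod_eq_single i]
  · simp
  · intro j _ hj
    change (g j).ofConv (Pi.mulSingle (M := fun _ => H) i x j) = 1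
    rw [Pi.mulSingle_eq_of_ne hj, map_one]
  · simp

lemma map_evalAt_coordPt {n : ℕ} (g : Fin n → Pt O H A) (i : Fin n) :
    Pt.map (evalAt g) (coordPt i) = g i :=
  WithConv.ext (evalAt_single g i)

lemma comp_evalAt (φ : A →ₐ[O] B) {n : ℕ} (g : Fin n → Pt O H A) :
    φ.comp (evalAt g) = evalAt fun i => Pt.map φ (g i) := by
  apply PiTensorProduct.algHom_ext
  intro i
  rw [AlgHom.comp_assoc, evalAt_single, evalAt_single]
  rfl

variable (O H) in
/-- `𝒪[Gⁿ]^{G⁰}`: the functions on `Gⁿ` invariant under simultaneous conjugation by `G⁰`. -/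
def invariants (n : ℕ) : Subalgebra O (Coord O H n) where
  carrier := {f | ∀ (A : Type u) [CommRing A] [Algebra O A] (h : Pt O H A), h ∈ neutralPt A →
    ∀ g : Fin n → Pt O H A, evalAt (fun i => h * g i * h⁻¹) f = evalAt g f}
  mul_mem' ha hb A _ _ h hh g := by rw [map_mul, map_mul, ha A h hh g, hb A h hh g]
  add_mem' ha hb A _ _ h hh g := by rw [map_add, map_add, ha A h hh g, hb A h hh g]
  algebraMap_mem' r A _ _ h hh g := by rw [AlgHom.commutes, AlgHom.commutes]

/-- `(g₁, …, gₙ, gₙ₊₁) ↦ (g₁, …, gₙ gₙ₊₁)`. -/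
def mulLast {M : Type*} [Mul M] {n : ℕ} (g : Fin (n + 2) → M) : Fin (n + 1) → M :=
  Fin.snoc (fun i : Fin n => g i.castSucc.castSucc)
    (g (Fin.last n).castSucc * g (Fin.last (n + 1)))

lemma map_mulLast {M N F : Type*} [Mul M] [Mul N] [FunLike F M N] [MulHomClass F M N] (φ : F)
    {n : ℕ} (g : Fin (n + 2) → M) (i : Fin (n + 1)) :
    φ (mulLast g i) = mulLast (fun j => φ (g j)) i := by
  induction i using Fin.lastCases <;> simp [mulLast]

/-- `f ↦ f^ζ`, where `f^ζ(g₁, …, gₙ) = f(g_{ζ(1)}, …, g_{ζ(m)})`. -/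
def reindexHom {m n : ℕ} (ζ : Fin m → Fin n) : Coord O H m →ₐ[O] Coord O H n :=
  evalAt fun j => coordPt (ζ j)

/-- `f ↦ f̂`, where `f̂(g₁, …, gₙ₊₁) = f(g₁, …, gₙ gₙ₊₁)`. -/
def hatHom (n : ℕ) : Coord O H (n + 1) →ₐ[O] Coord O H (n + 2) :=
  evalAt (mulLast coordPt)

lemma evalAt_reindexHom {m n : ℕ} (ζ : Fin m → Fin n) (f : Coord O H m) (g : Fin n → Pt O H A) :
    evalAt g (reindexHom ζ f) = evalAt (fun j => g (ζ j)) f := by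
  have h := congrArg (fun ψ => ψ f) (comp_evalAt (evalAt g) fun j => coordPt (ζ j))
  simp only [map_evalAt_coordPt] at h
  exact h

lemma evalAt_hatHom {n : ℕ} (f : Coord O H (n + 1)) (g : Fin (n + 2) → Pt O H A) :
    evalAt g (hatHom n f) = evalAt (mulLast g) f := by
  have h := congrArg (fun ψ => ψ f) (comp_evalAt (evalAt g) (mulLast coordPt))
  simp only [map_mulLast, map_evalAt_coordPt] at h
  exact h

lemma reindexHom_mem {m n : ℕ} (ζ : Fin m → Fin n) {f : Coord O H m}
    (hf : f ∈ invariants O H m) : reindexHom ζ f ∈ invariants O H n := by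
  intro A _ _ h hh g
  rw [evalAt_reindexHom, evalAt_reindexHom]
  exact hf A h hh _

lemma hatHom_mem {n : ℕ} {f : Coord O H (n + 1)}
    (hf : f ∈ invariants O H (n + 1)) : hatHom n f ∈ invariants O H (n + 2) := by
  intro A _ _ h hh g
  rw [evalAt_hatHom, evalAt_hatHom, ← hf A h hh (mulLast g)]
  congr 2
  funext i
  exact (map_mulLast (MulAut.conj h) g i).symm

/-- Pullback of functions along a morphism `G = Spec H → G' = Spec H'`. -/
def pullHom {H' : Type u} [CommRing H'] [HopfAlgebra O H'] (p : H' →ₐc[O] H) (n : ℕ) :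
    Coord O H' n →ₐ[O] Coord O H n :=
  evalAt fun i => Pt.push p (coordPt i)

lemma evalAt_pullHom {H' : Type u} [CommRing H'] [HopfAlgebra O H'] (p : H' →ₐc[O] H) {n : ℕ}
    (f : Coord O H' n) (g : Fin n → Pt O H A) :
    evalAt g (pullHom p n f) = evalAt (fun i => Pt.push p (g i)) f := by
  have h := congrArg (fun ψ => ψ f) (comp_evalAt (evalAt g) fun i => Pt.push p (coordPt i))
  have h' : ∀ i, Pt.map (evalAt g) (Pt.push p (coordPt i)) = Pt.push p (g i) := fun i => by
    conv_rhs => rw [← map_evalAt_coordPt g i]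
    rfl
  simp only [h'] at h
  exact h

lemma coord_ext {n : ℕ} {f f' : Coord O H n}
    (h : ∀ (A : Type u) [CommRing A] [Algebra O A] (g : Fin n → Pt O H A),
      evalAt g f = evalAt g f') : f = f' := by
  have h1 : evalAt (coordPt (O := O) (H := H) (n := n)) = AlgHom.id O _ := by
    apply PiTensorProduct.algHom_ext
    intro i
    rw [evalAt_single]
    rfl
  simpa [h1] using h _ coordPt

lemma push_mem_neutralPt {H' : Type u} [CommRing H'] [HopfAlgebra O H'] (p : H' →ₐc[O] H)
    {h : Pt O H A} (hh : h ∈ neutralPt A) : Pt.push p h ∈ neutralPt (H := H') A := by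
  intro t
  have key : ∀ x ∈ neutralLocus O H,
      PrimeSpectrum.comap (p : H' →ₐ[O] H).toRingHom x ∈ neutralLocus O H' := by
    intro x hx
    have e1 : ∀ y, PrimeSpectrum.comap (algebraMap O H')
        (PrimeSpectrum.comap (p : H' →ₐ[O] H).toRingHom y) =
          PrimeSpectrum.comap (algebraMap O H) y := by
      intro y
      rw [← PrimeSpectrum.comap_comp_apply]
      congr 2
      exact (p : H' →ₐ[O] H).comp_algebraMap
    have e2 : ∀ s, PrimeSpectrum.comap (p : H' →ₐ[O] H).toRingHom
        (PrimeSpectrum.comap (Bialgebra.counitAlgHom O H).toRingHom s) =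
          PrimeSpectrum.comap (Bialgebra.counitAlgHom O H').toRingHom s := by
      intro s
      rw [← PrimeSpectrum.comap_comp_apply]
      congr 2
      ext y
      simp
    have hne : PrimeSpectrum.comap (Bialgebra.counitAlgHom O H).toRingHom
        (PrimeSpectrum.comap (algebraMap O H) x) ∈ PrimeSpectrum.comap (algebraMap O H) ⁻¹'
          {PrimeSpectrum.comap (algebraMap O H) x} := by
      by_contra hn
      have hx' : x ∈ connectedComponentIn _ _ := hx
      rw [connectedComponentIn_eq_empty hn] at hx'
      exact hx'
    have h1 := (PrimeSpectrum.continuous_comap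
      (p : H' →ₐ[O] H).toRingHom).continuousOn.image_connectedComponentIn_subset hne
        ⟨x, hx, rfl⟩
    rw [e2] at h1
    change _ ∈ connectedComponentIn _ _
    rw [e1]
    refine connectedComponentIn_mono _ ?_ h1
    rintro _ ⟨y, hy, rfl⟩
    rw [Set.mem_preimage, e1]
    exact hy
  have := key _ (hh t)
  rwa [← PrimeSpectrum.comap_comp_apply] at this

lemma pullHom_mem {H' : Type u} [CommRing H'] [HopfAlgebra O H'] (p : H' →ₐc[O] H) {n : ℕ}
    {f : Coord O H' n} (hf : f ∈ invariants O H' n) : pullHom p n f ∈ invariants O H n := by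
  intro A _ _ h hh g
  rw [evalAt_pullHom, evalAt_pullHom, ← hf A _ (push_mem_neutralPt p hh) fun i => Pt.push p (g i)]
  simp only [map_mul, map_inv]

end Functions

/-! ### Pseudocharacters -/

section PseudoChar

variable (O H Γ : Type u) [CommRing O] [CommRing H] [HopfAlgebra O H] [Group Γ]

/-- An `A`-valued `G`-pseudocharacter of `Γ`: a sequence `(Θₙ)_{n ≥ 1}` of `𝒪`-algebra maps
`𝒪[Gⁿ]^{G⁰} → Map(Γⁿ, A)`. The map with index `n : ℕ` below is `Θₙ₊₁`. -/
@[ext]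
structure PseudoChar (A : Type u) [CommRing A] [Algebra O A] where
  Θ : ∀ n : ℕ, invariants O H (n + 1) →ₐ[O] ((Fin (n + 1) → Γ) → A)
  reindex : ∀ (m n : ℕ) (ζ : Fin (m + 1) → Fin (n + 1)) (f : invariants O H (m + 1))
    (γ : Fin (n + 1) → Γ),
    Θ n ⟨reindexHom ζ f, reindexHom_mem ζ f.2⟩ γ = Θ m f (fun j => γ (ζ j))
  hat : ∀ (n : ℕ) (f : invariants O H (n + 1)) (γ : Fin (n + 2) → Γ),
    Θ (n + 1) ⟨hatHom n f, hatHom_mem f.2⟩ γ = Θ n f (mulLast γ)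

variable {O H Γ} {A B : Type u} [CommRing A] [Algebra O A] [CommRing B] [Algebra O B]

/-- Specialisation of a pseudocharacter along `A → B`. -/
def PseudoChar.map (φ : A →ₐ[O] B) (T : PseudoChar O H Γ A) : PseudoChar O H Γ B where
  Θ n := AlgHom.pi fun γ => φ.comp ((Pi.evalAlgHom O (fun _ => A) γ).comp (T.Θ n))
  reindex m n ζ f γ := congrArg φ (T.reindex m n ζ f γ)
  hat n f γ := congrArg φ (T.hat n f γ)

/-- The pseudocharacter `Θ_ρ` of a representation `ρ : Γ → G(A)`:
`(Θ_ρ)ₙ(f)(γ₁, …, γₙ) = f(ρ(γ₁), …, ρ(γₙ))`. -/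
def PseudoChar.ofRep (ρ : Γ →* Pt O H A) : PseudoChar O H Γ A where
  Θ n := AlgHom.pi fun γ => (evalAt fun i => ρ (γ i)).comp (invariants O H (n + 1)).val
  reindex m n ζ f γ := evalAt_reindexHom ζ f.1 fun i => ρ (γ i)
  hat n f γ := by
    refine (evalAt_hatHom f.1 fun i => ρ (γ i)).trans ?_
    have h : mulLast (fun i => ρ (γ i)) = fun i => ρ (mulLast γ i) :=
      funext fun i => (map_mulLast ρ γ i).symm
    rw [h]
    rfl

/-- The image of a `G`-pseudocharacter under a morphism `G = Spec H → G' = Spec H'`. -/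
def PseudoChar.push {H' : Type u} [CommRing H'] [HopfAlgebra O H'] (p : H' →ₐc[O] H)
    (T : PseudoChar O H Γ A) : PseudoChar O H' Γ A where
  Θ n := (T.Θ n).comp (((pullHom p (n + 1)).comp (invariants O H' (n + 1)).val).codRestrict
    (invariants O H (n + 1)) fun f => pullHom_mem p f.2)
  reindex m n ζ f γ := by
    refine Eq.trans ?_ (T.reindex m n ζ ⟨pullHom p (m + 1) f, pullHom_mem p f.2⟩ γ)
    have : pullHom p (n + 1) (reindexHom ζ f.1) = reindexHom ζ (pullHom p (m + 1) f.1) :=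
      coord_ext fun A _ _ g => by simp only [evalAt_pullHom, evalAt_reindexHom]
    exact congrArg (fun x => T.Θ n x γ) (Subtype.ext this)
  hat n f γ := by
    refine Eq.trans ?_ (T.hat n ⟨pullHom p (n + 1) f, pullHom_mem p f.2⟩ γ)
    have : pullHom p (n + 2) (hatHom n f.1) = hatHom n (pullHom p (n + 1) f.1) :=
      coord_ext fun A _ _ g => by
        simp only [evalAt_pullHom, evalAt_hatHom]
        congr 2
        funext i
        exact (map_mulLast (Pt.push p) g i).symm
    exact congrArg (fun x => T.Θ (n + 1) x γ) (Subtype.ext this)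

end PseudoChar

/-! ### Constant group schemes -/

/-- `Map(Δ, 𝒪)`, the coordinate ring of the constant group scheme attached to `Δ`. -/
def ConstCoord (O Δ : Type*) : Type _ := Δ → O

namespace ConstCoord
variable (O Δ : Type*) [CommRing O]

instance : CommRing (ConstCoord O Δ) := inferInstanceAs (CommRing (Δ → O))
instance : Algebra O (ConstCoord O Δ) := inferInstanceAs (Algebra O (Δ → O))

variable {Δ}

/-- Evaluation `Map(Δ, 𝒪) → 𝒪` at `δ`. -/
def ev (δ : Δ) : ConstCoord O Δ →ₐ[O] O := Pi.evalAlgHom O (fun _ => O) δ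

/-- The algebra map to `Map(Δ, 𝒪)` with given components. -/
def lift {B : Type*} [CommRing B] [Algebra O B] (φ : Δ → (B →ₐ[O] O)) : B →ₐ[O] ConstCoord O Δ :=
  AlgHom.pi (A := fun _ : Δ => O) φ

lemma ev_lift {B : Type*} [CommRing B] [Algebra O B] (φ : Δ → (B →ₐ[O] O)) (δ : Δ) (x : B) :
    ev O δ (lift O φ x) = φ δ x := rfl

lemma ext {f g : ConstCoord O Δ} (h : ∀ δ, ev O δ f = ev O δ g) : f = g := funext h

variable [DecidableEq Δ]

/-- The indicator function of `{δ}`. -/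
def ind (δ : Δ) : ConstCoord O Δ := Pi.single (M := fun _ => O) δ 1

variable {O}
lemma ev_ind (a b : Δ) : ev O a (ind O b) = if a = b then 1 else 0 := Pi.single_apply b 1 a

lemma ind_mul_ind (a b : Δ) : ind O a * ind O b = if a = b then ind O a else 0 := by
  apply ext
  intro c
  rw [map_mul, ev_ind, ev_ind]
  split_ifs <;> simp_all [ev_ind]

/-- The antipode `f ↦ (a ↦ f(a⁻¹))`. -/
def antipodeHom [Group Δ] : ConstCoord O Δ →ₐ[O] ConstCoord O Δ := lift O fun a => ev O a⁻¹

lemma antipodeHom_ind [Group Δ] (x : Δ) : antipodeHom (ind O x) = ind O x⁻¹ := by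
  apply ext
  intro c
  simp [antipodeHom, ev_lift, ev_ind, inv_eq_iff_eq_inv]

variable [Fintype Δ]

lemma sum_ind : ∑ a : Δ, ind O a = 1 := by
  apply ext
  intro c
  simp [ev_ind]

lemma hom_ext {M : Type*} [AddCommMonoid M] [Module O M] {f g : ConstCoord O Δ →ₗ[O] M}
    (h : ∀ δ, f (ind O δ) = g (ind O δ)) : f = g :=
  (Pi.basisFun O Δ).ext (f₁ := f) (f₂ := g) fun δ => by
    rw [Pi.basisFun_apply]; exact h δ

lemma algHom_ext {M : Type*} [Semiring M] [Algebra O M] {f g : ConstCoord O Δ →ₐ[O] M}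
    (h : ∀ δ, f (ind O δ) = g (ind O δ)) : f = g :=
  AlgHom.toLinearMap_injective (hom_ext h)

variable (O Δ) [Group Δ]

/-- The comultiplication `f ↦ ((a, b) ↦ f(ab))`, with `Map(Δ, 𝒪) ⊗ Map(Δ, 𝒪) ≅ Map(Δ × Δ, 𝒪)`. -/
def comulHom : ConstCoord O Δ →ₐ[O] ConstCoord O Δ ⊗[O] ConstCoord O Δ :=
  (Algebra.TensorProduct.piScalarRight O O (ConstCoord O Δ) Δ).symm.toAlgHom.comp
    (AlgHom.pi fun b => lift O fun a => ev O (a * b))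

variable {O Δ}

lemma comulHom_ind (x : Δ) : comulHom O Δ (ind O x) = ∑ a, ind O a ⊗ₜ[O] ind O (a⁻¹ * x) := by
  apply (Algebra.TensorProduct.piScalarRight O O (ConstCoord O Δ) Δ).injective
  refine ((Algebra.TensorProduct.piScalarRight O O (ConstCoord O Δ) Δ).apply_symm_apply _).trans ?_
  refine Eq.trans ?_ (map_sum (Algebra.TensorProduct.piScalarRight O O (ConstCoord O Δ) Δ)
    (fun a => ind O a ⊗ₜ[O] ind O (a⁻¹ * x)) Finset.univ).symm
  funext b
  rw [Finset.sum_apply]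
  refine Eq.trans ?_ (Finset.sum_congr rfl fun a _ => (congrFun
    (Algebra.TensorProduct.piScalarRight_tmul (R := O) O (A := ConstCoord O Δ) (ι := Δ)
      (ind O a) (ind O (a⁻¹ * x) : Δ → O)) b).symm)
  apply ext
  intro c
  change ev O (c * b) (ind O x) = ev O c (∑ a, ev O b (ind O (a⁻¹ * x)) • ind O a)
  simp only [map_sum, map_smul, ev_ind, eq_inv_mul_iff_mul_eq, smul_eq_mul]
  simp

instance : Bialgebra O (ConstCoord O Δ) :=
  Bialgebra.ofAlgHom (comulHom O Δ) (ev O 1)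
    (algHom_ext fun x => by
      simp only [AlgHom.coe_comp, Function.comp_apply, comulHom_ind, map_sum,
        Algebra.TensorProduct.map_tmul, TensorProduct.sum_tmul, TensorProduct.tmul_sum,
        AlgHom.coe_id, id_eq]
      rw [Finset.sum_comm]
      refine Finset.sum_congr rfl fun c _ => ?_
      exact (Fintype.sum_equiv (Equiv.mulLeft c) _ _ fun d => by simp [mul_assoc]).symm)
    (algHom_ext fun x => by
      simp only [AlgHom.coe_comp, Function.comp_apply, comulHom_ind, map_sum,
        Algebra.TensorProduct.map_tmul, ev_ind, AlgHom.coe_id, id_eq]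
      rw [Finset.sum_eq_single 1] <;> simp +contextual [eq_comm])
    (algHom_ext fun x => by
      simp only [AlgHom.coe_comp, Function.comp_apply, comulHom_ind, map_sum,
        Algebra.TensorProduct.map_tmul, ev_ind, AlgHom.coe_id, id_eq]
      rw [Finset.sum_eq_single x] <;> simp +contextual [eq_inv_mul_iff_mul_eq])

instance : HopfAlgebra O (ConstCoord O Δ) :=
  HopfAlgebra.ofAlgHom antipodeHom
    (algHom_ext fun x => by
      change Algebra.TensorProduct.lift _ _ (fun _ _ => Commute.all _ _) (comulHom O Δ (ind O x)) =
        algebraMap O _ (ev O 1 (ind O x))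
      simp only [comulHom_ind, map_sum, Algebra.TensorProduct.lift_tmul, antipodeHom_ind,
        AlgHom.coe_id, id_eq, ind_mul_ind, ev_ind]
      by_cases h : 1 = x
      · subst h
        simpa using (Equiv.sum_comp (Equiv.inv Δ) fun a => ind O a).trans sum_ind
      · simp [h, Ne.symm h])
    (algHom_ext fun x => by
      change Algebra.TensorProduct.lift _ _ (fun _ _ => Commute.all _ _) (comulHom O Δ (ind O x)) =
        algebraMap O _ (ev O 1 (ind O x))
      simp only [comulHom_ind, map_sum, Algebra.TensorProduct.lift_tmul, antipodeHom_ind,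
        AlgHom.coe_id, id_eq, ind_mul_ind, ev_ind]
      by_cases h : 1 = x
      · subst h
        simp [sum_ind]
      · simp [h, Ne.symm h])

/-- The homomorphism from `Δ` to the `A`-points of the constant group scheme attached to `Δ`. -/
def point (A : Type*) [CommRing A] [Algebra O A] : Δ →* Pt O (ConstCoord O Δ) A where
  toFun δ := toConv ((Algebra.ofId O A).comp (ev O δ))
  map_one' := rfl
  map_mul' a b := by
    apply WithConv.ext
    refine algHom_ext fun x => ?_
    refine Eq.trans ?_ (AlgHom.convMul_apply _ _ _).symm
    change algebraMap O A (ev O (a * b) (ind O x)) =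
      Algebra.TensorProduct.lift _ _ (fun _ _ => Commute.all _ _) (comulHom O Δ (ind O x))
    simp only [comulHom_ind, map_sum, Algebra.TensorProduct.lift_tmul, AlgHom.coe_comp,
      Function.comp_apply, ev_ind, Algebra.ofId_apply]
    rw [Finset.sum_eq_single a] <;> simp +contextual [eq_inv_mul_iff_mul_eq, eq_comm]

end ConstCoord

/-! ### The moduli functors -/

section Moduli

variable {O H Γ : Type u} [CommRing O] [CommRing H] [HopfAlgebra O H] [Group Γ]

/-- `(R, ρ)` represents `Rep^Γ_G`, the functor sending an `𝒪`-algebra `A` to the set of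
representations `Γ → G(A)`. -/
def IsUniversalRep {R : Type u} [CommRing R] [Algebra O R] (ρ : Γ →* Pt O H R) : Prop :=
  ∀ (A : Type u) [CommRing A] [Algebra O A] (σ : Γ →* Pt O H A),
    ∃! φ : R →ₐ[O] A, (Pt.map φ).comp ρ = σ

/-- `(P, T)` represents `PC^Γ_G`, the functor sending an `𝒪`-algebra `A` to the set of `A`-valued
`G`-pseudocharacters of `Γ`. -/
def IsUniversalPseudoChar {P : Type u} [CommRing P] [Algebra O P] (T : PseudoChar O H Γ P) : Prop :=
  ∀ (A : Type u) [CommRing A] [Algebra O A] (S : PseudoChar O H Γ A),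
    ∃! φ : P →ₐ[O] A, T.map φ = S

/-- The ring `R^{G⁰}`, for `R` representing a functor of representations of `Γ` with universal
object `ρ`: the functions `r` on `Spec R` invariant under the action of `G⁰` by conjugation. The
morphisms `φ`, `φ'` below are the `A`-points of `Spec R`. -/
def repInvariants {R : Type u} [CommRing R] [Algebra O R] (ρ : Γ →* Pt O H R) :
    Subalgebra O R where
  carrier := {r | ∀ (A : Type u) [CommRing A] [Algebra O A] (h : Pt O H A), h ∈ neutralPt A →
    ∀ φ φ' : R →ₐ[O] A,
      (∀ γ, Pt.map φ' (ρ γ) = h * Pt.map φ (ρ γ) * h⁻¹) → φ' r = φ r}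
  mul_mem' ha hb A _ _ h hh φ φ' e := by
    rw [map_mul, map_mul, ha A h hh φ φ' e, hb A h hh φ φ' e]
  add_mem' ha hb A _ _ h hh φ φ' e := by
    rw [map_add, map_add, ha A h hh φ φ' e, hb A h hh φ φ' e]
  algebraMap_mem' r A _ _ h hh φ φ' e := by rw [AlgHom.commutes, AlgHom.commutes]

variable {Δ : Type u} [Group Δ] [Fintype Δ] [DecidableEq Δ] (p : ConstCoord O Δ →ₐc[O] H)
  (π : Γ →* Δ)

/-- `ρ : Γ → G(A)` is admissible: its composite with `Π : G → Δ` (given by `p`) is `π`. -/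
def IsAdmissibleRep {A : Type u} [CommRing A] [Algebra O A] (ρ : Γ →* Pt O H A) : Prop :=
  (Pt.push p).comp ρ = (ConstCoord.point A).comp π

/-- A `G`-pseudocharacter is admissible: its image under `Π : G → Δ` is the pseudocharacter
attached to `π`. -/
def IsAdmissiblePseudoChar {A : Type u} [CommRing A] [Algebra O A]
    (T : PseudoChar O H Γ A) : Prop :=
  T.push p = PseudoChar.ofRep ((ConstCoord.point A).comp π)

/-- `(R, ρ)` represents the functor `Rep^Γ_{G,π}` of admissible representations. -/
def IsUniversalAdmissibleRep {R : Type u} [CommRing R] [Algebra O R] (ρ : Γ →* Pt O H R) : Prop :=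
  IsAdmissibleRep p π ρ ∧
  ∀ (A : Type u) [CommRing A] [Algebra O A] (σ : Γ →* Pt O H A), IsAdmissibleRep p π σ →
    ∃! φ : R →ₐ[O] A, (Pt.map φ).comp ρ = σ

/-- `(P, T)` represents the functor `PC^Γ_{G,π}` of admissible pseudocharacters. -/
def IsUniversalAdmissiblePseudoChar {P : Type u} [CommRing P] [Algebra O P]
    (T : PseudoChar O H Γ P) : Prop :=
  IsAdmissiblePseudoChar p π T ∧
  ∀ (A : Type u) [CommRing A] [Algebra O A] (S : PseudoChar O H Γ A),
    IsAdmissiblePseudoChar p π S → ∃! φ : P →ₐ[O] A, T.map φ = S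

end Moduli

end

end GenTorus

/-!
A torus carries a normalised invariant integral `𝒪[T] → 𝒪`. On a split torus it is the coefficient
of the trivial character; an invariant integral is unique, even with values in an arbitrary
`𝒪`-algebra, so the split integrals descend along an fpqc cover. Averaging over conjugation by `G⁰`
is then a Reynolds operator `E : 𝒪[Gⁿ] → 𝒪[Gⁿ]^{G⁰}`, linear over the invariants and natural in `n`:
it commutes with `f ↦ f^ζ` and with `f ↦ f̂`.

The ring `𝒪(Rep)` is spanned by the values `f(ρ(γ₁), …, ρ(γₙ))` at the universal representation `ρ`.
For a pseudocharacter `S` the rule `f(ρ(γ₁), …, ρ(γₙ)) ↦ Sₙ(E f)(γ₁, …, γₙ)` is a well-defined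
linear functional on `𝒪(Rep)`, by naturality of `E` and the two axioms for `S`. Since `E` is linear
over invariants, the functional is multiplicative on `𝒪(Rep)^{G⁰}`. So every pseudocharacter
factors through the one with values in `𝒪(Rep)^{G⁰}`, uniquely because `E` also shows that the
values of invariant functions exhaust this ring. Admissibility only fixes some values `Sₙ(f)(γ)`,
and every step respects conditions of this kind.
-/

namespace GenTorus

noncomputable section

/-! ### Invariant integrals on Hopf algebras -/

section Antipode

variable {O T D : Type*} [CommRing O] [CommRing T] [HopfAlgebra O T] [CommRing D] [Algebra O D]

lemma antipode_antipode (x : T) : HopfAlgebra.antipode O (HopfAlgebra.antipode O x) = x :=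
  congrArg (fun g : Pt O T T => g.ofConv x) (inv_inv (toConv (AlgHom.id O T)))

lemma comul_antipode (x : T) :
    Coalgebra.comul (R := O) (HopfAlgebra.antipode O x) =
      TensorProduct.map (HopfAlgebra.antipode O) (HopfAlgebra.antipode O)
        (TensorProduct.comm O T T (Coalgebra.comul x)) := by
  let i₁ : Pt O T (T ⊗[O] T) := toConv Algebra.TensorProduct.includeLeft
  let i₂ : Pt O T (T ⊗[O] T) := toConv Algebra.TensorProduct.includeRight
  have comul_eq : toConv (Bialgebra.comulAlgHom O T) = i₁ * i₂ := by
    refine WithConv.ext (AlgHom.ext fun y => ?_)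
    rw [AlgHom.convMul_apply]
    change Coalgebra.comul y = _
    generalize (Coalgebra.comul (R := O) y) = z
    induction z with
    | zero => simp
    | add a b ha hb => rw [map_add, ← ha, ← hb]
    | tmul a b => simp [i₁, i₂]
  have h := congrArg (fun g : Pt O T (T ⊗[O] T) => g.ofConv x)
    ((congrArg Inv.inv comul_eq).trans (mul_inv_rev i₁ i₂))
  refine h.trans ?_
  change (i₂⁻¹ * i₁⁻¹).ofConv x = _
  rw [AlgHom.convMul_apply]
  generalize (Coalgebra.comul (R := O) x) = z
  induction z with
  | zero => simp
  | add a b ha hb => simp only [map_add, ha, hb]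
  | tmul a b =>
    change (1 ⊗ₜ[O] HopfAlgebra.antipode O a) * (HopfAlgebra.antipode O b ⊗ₜ[O] 1) = _
    simp

lemma toConv_comp_antipode_mul (f g : T →ₗ[O] D) :
    toConv (f ∘ₗ HopfAlgebra.antipode O) * toConv (g ∘ₗ HopfAlgebra.antipode O) =
      toConv ((toConv g * toConv f).ofConv ∘ₗ HopfAlgebra.antipode O) := by
  refine WithConv.ext (LinearMap.ext fun x => ?_)
  simp only [LinearMap.convMul_def, ofConv_toConv, LinearMap.comp_apply]
  rw [comul_antipode]
  generalize (Coalgebra.comul (R := O) x) = z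
  induction z with
  | zero => simp
  | add a b ha hb => simp only [map_add, ha, hb]
  | tmul a b => simp [mul_comm]

end Antipode

section Integral

variable {O T D D' : Type*} [CommRing O] [CommRing T] [HopfAlgebra O T]
  [CommRing D'] [Algebra O D'] [CommRing D] [Algebra O D]

/-- `L : T → D` is a normalised integral on the group scheme `Spec T`, with values in the
`O`-algebra `D`: it is invariant under right translation, `∫ x(gh) dg = ∫ x(g) dg`. -/
structure IsHaar (L : T →ₗ[O] D) : Prop where
  map_one : L 1 = 1
  rTensor_comul : ∀ x, L.rTensor T (Coalgebra.comul (R := O) x) = L x ⊗ₜ 1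

lemma IsHaar.comp {L : T →ₗ[O] D} (hL : IsHaar L) (φ : D →ₐ[O] D') :
    IsHaar (φ.toLinearMap ∘ₗ L) where
  map_one := by simp [hL.map_one]
  rTensor_comul x := by simp [LinearMap.rTensor_comp, hL.rTensor_comul]

lemma IsHaar.mul_eq_self {L N : T →ₗ[O] D} (hL : IsHaar L) (hN : N 1 = 1) :
    toConv L * toConv N = toConv L := by
  refine WithConv.ext (LinearMap.ext fun x => ?_)
  have h := congrArg (LinearMap.mul' O D ∘ₗ N.lTensor D) (hL.rTensor_comul x)
  rw [LinearMap.comp_apply, ← LinearMap.comp_apply (N.lTensor D), LinearMap.lTensor_comp_rTensor]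
    at h
  simpa [hN] using h

lemma IsHaar.eq_comp_antipode {L M : T →ₗ[O] D} (hL : IsHaar L) (hM : IsHaar M) :
    L = M ∘ₗ HopfAlgebra.antipode O := by
  have antipode_comp_antipode : HopfAlgebra.antipode O ∘ₗ HopfAlgebra.antipode O =
      (LinearMap.id : T →ₗ[O] T) := LinearMap.ext antipode_antipode
  have h := toConv_comp_antipode_mul (L ∘ₗ HopfAlgebra.antipode O) M
  rw [hM.mul_eq_self (by simp [hL.map_one]), LinearMap.comp_assoc, antipode_comp_antipode,
    LinearMap.comp_id, hL.mul_eq_self (by simp [hM.map_one])] at h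
  exact toConv_injective h

lemma IsHaar.unique {L M : T →ₗ[O] D} (hL : IsHaar L) (hM : IsHaar M) : L = M :=
  (hL.eq_comp_antipode hM).trans (hM.eq_comp_antipode hM).symm

lemma IsHaar.pi {k : ℕ} {D : Fin k → Type*} [∀ i, CommRing (D i)] [∀ i, Algebra O (D i)]
    {L : ∀ i, T →ₗ[O] D i} (hL : ∀ i, IsHaar (L i)) : IsHaar (LinearMap.pi L) := by
  have piLeft_rTensor : ∀ (z : T ⊗[O] T) i,
      TensorProduct.piLeft O T D ((LinearMap.pi L).rTensor T z) i = (L i).rTensor T z := by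
    intro z i
    induction z with
    | zero => simp
    | add a b ha hb => rw [map_add, map_add, Pi.add_apply, ha, hb, map_add]
    | tmul a b => simp
  refine ⟨funext fun i => (hL i).map_one, fun x =>
    (TensorProduct.piLeft O T D).injective (funext fun i => ?_)⟩
  rw [piLeft_rTensor, (hL i).rTensor_comul]
  simp

lemma IsHaar.descend [Module.FaithfullyFlat O D] {L : T →ₗ[O] D} (hL : IsHaar L) :
    ∃ I : T →ₗ[O] O, IsHaar I := by
  have includeLeft_eq_includeRight :=
    (hL.comp (Algebra.TensorProduct.includeLeft (S := O) (A := D) (B := D))).unique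
      (hL.comp (Algebra.TensorProduct.includeRight (A := D) (B := D)))
  have mem_range : ∀ x, L x ∈ LinearMap.range (Algebra.linearMap O D) := fun x =>
    (Algebra.IsEffective.of_faithfullyFlat O D (L x)).mp
      (sub_eq_zero.mpr (LinearMap.congr_fun includeLeft_eq_includeRight x))
  have algebraMap_injective : Function.Injective (Algebra.linearMap O D) :=
    FaithfulSMul.algebraMap_injective O D
  let e := LinearEquiv.ofInjective _ algebraMap_injective
  let I : T →ₗ[O] O := e.symm.toLinearMap ∘ₗ L.codRestrict _ mem_range
  have algebraMap_I : ∀ x, algebraMap O D (I x) = L x := fun x =>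
    congrArg Subtype.val (e.apply_symm_apply (L.codRestrict _ mem_range x))
  have one_tmul_I : ∀ z : T ⊗[O] T, (1 : D) ⊗ₜ[O] TensorProduct.lid O T (I.rTensor T z) =
      L.rTensor T z := by
    intro z
    induction z with
    | zero => simp
    | add a b ha hb => simp only [map_add, TensorProduct.tmul_add, ha, hb]
    | tmul a b =>
      simp [← algebraMap_I, Algebra.algebraMap_eq_smul_one, TensorProduct.smul_tmul]
  refine ⟨I, algebraMap_injective ((algebraMap_I 1).trans (by simp [hL.map_one])), fun x =>
    (TensorProduct.lid O T).injective
      (Module.FaithfullyFlat.tensorProduct_mk_injective (A := O) (B := D) T ?_)⟩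
  simp only [TensorProduct.mk_apply, one_tmul_I, hL.rTensor_comul, TensorProduct.lid_tmul,
    ← TensorProduct.smul_tmul, ← algebraMap_I, Algebra.algebraMap_eq_smul_one]

lemma isHaar_coeff_zero (D M : Type*) [CommRing D] [AddCommGroup M] :
    IsHaar (O := D) (T := AddMonoidAlgebra D M) (D := D)
      (Finsupp.lapply 0 ∘ₗ (AddMonoidAlgebra.coeffLinearEquiv D).toLinearMap) := by
  refine ⟨by simp, fun x => ?_⟩
  induction x using AddMonoidAlgebra.induction_linear with
  | zero => simp
  | add a b ha hb => simp only [map_add, ha, hb, TensorProduct.add_tmul]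
  | single m d =>
    obtain rfl | hm := eq_or_ne m 0
    · have single_eq_smul_one : AddMonoidAlgebra.single 0 d = d • (1 : AddMonoidAlgebra D M) := by
        simp [AddMonoidAlgebra.one_def]
      simp [single_eq_smul_one, Algebra.TensorProduct.one_def, TensorProduct.smul_tmul']
    · simp [hm]

lemma IsHaar.of_equiv {T' : Type*} [CommRing T'] [HopfAlgebra O T'] (e : T ≃ₐc[O] T')
    {L : T' →ₗ[O] D} (hL : IsHaar L) : IsHaar (L ∘ₗ (e : T →ₗ[O] T')) := by
  have lTensor_injective : Function.Injective ((e : T →ₗ[O] T').lTensor D) :=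
    (LinearEquiv.lTensor D (e : T ≃ₗ[O] T')).injective
  refine ⟨by simp [hL.map_one], fun x => lTensor_injective ?_⟩
  rw [← LinearMap.comp_apply, LinearMap.lTensor_comp_rTensor, ← LinearMap.rTensor_comp_map,
    LinearMap.comp_apply]
  refine (congrArg _ (CoalgHomClass.map_comp_comul_apply e x)).trans ?_
  simp [hL.rTensor_comul]

lemma IsHaar.of_baseChange {L : D ⊗[O] T →ₗ[D] D} (hL : IsHaar L) :
    IsHaar (L.restrictScalars O ∘ₗ
      (Algebra.TensorProduct.includeRight (R := O) (A := D) (B := T)).toLinearMap) := by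
  set L₀ := L.restrictScalars O ∘ₗ
    (Algebra.TensorProduct.includeRight (R := O) (A := D) (B := T)).toLinearMap with hL₀
  let J (z : T ⊗[O] T) : (D ⊗[O] T) ⊗[D] (D ⊗[O] T) :=
    TensorProduct.AlgebraTensorModule.tensorTensorTensorComm O D O D D D T T
      (((1 : D) ⊗ₜ[D] (1 : D)) ⊗ₜ[O] z)
  have lid_rTensor_J : ∀ z : T ⊗[O] T,
      TensorProduct.lid D (D ⊗[O] T) (L.rTensor (D ⊗[O] T) (J z)) = L₀.rTensor T z := by
    intro z
    induction z with
    | zero => simp [J]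
    | add a b ha hb => simp only [J, TensorProduct.tmul_add, map_add] at ha hb ⊢; rw [ha, hb]
    | tmul a b => simp [J, hL₀, TensorProduct.smul_tmul']
  refine ⟨hL.map_one, fun x => ?_⟩
  have J_comul : J (Coalgebra.comul x) = Coalgebra.comul (R := D) ((1 : D) ⊗ₜ[O] x) := by simp [J]
  rw [← lid_rTensor_J, J_comul, hL.rTensor_comul]
  simp [hL₀, Algebra.TensorProduct.one_def, TensorProduct.smul_tmul']

end Integral

theorem IsTorus.exists_isHaar {O T : Type u} [CommRing O] [CommRing T] [HopfAlgebra O T]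
    (hT : IsTorus O T) : ∃ I : T →ₗ[O] O, IsHaar I := by
  obtain ⟨k, O', _, _, n, hflat, hsurj, he⟩ := hT
  choose L hL using fun i : Fin k => show ∃ L : T →ₗ[O] O' i, IsHaar L from
    ⟨_, ((isHaar_coeff_zero (O' i) (Fin (n i) → ℤ)).of_equiv (he i).some).of_baseChange⟩
  have : Module.Flat O (∀ i, O' i) :=
    Module.Flat.of_linearEquiv (DFinsupp.linearEquivFunOnFintype (R := O) (M := O')).symm
  have : Module.FaithfullyFlat O (∀ i, O' i) := by
    refine Module.FaithfullyFlat.of_comap_surjective fun s => ?_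
    obtain ⟨i, t, rfl⟩ := hsurj s
    exact ⟨PrimeSpectrum.comap (Pi.evalRingHom O' i) t,
      (PrimeSpectrum.comap_comp_apply _ _ _).symm⟩
  exact (IsHaar.pi hL).descend

/-! ### The Reynolds operator -/

section Integrate

variable {O T A B : Type*} [CommRing O] [CommRing T] [Algebra O T]
  [CommRing A] [Algebra O A] [CommRing B] [Algebra O B]

/-- Integration along `T`: the `A`-linear extension `A ⊗ T → A` of the functional `I : T → O`. -/
def integrate (I : T →ₗ[O] O) (A : Type*) [CommRing A] [Algebra O A] : A ⊗[O] T →ₗ[O] A :=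
  (TensorProduct.rid O A).toLinearMap ∘ₗ I.lTensor A

@[simp]
lemma integrate_tmul (I : T →ₗ[O] O) (a : A) (t : T) : integrate I A (a ⊗ₜ t) = I t • a := by
  simp [integrate]

lemma integrate_tmul_one_mul (I : T →ₗ[O] O) (a : A) (z : A ⊗[O] T) :
    integrate I A (a ⊗ₜ 1 * z) = a * integrate I A z := by
  induction z with
  | zero => simp
  | add x y hx hy => rw [mul_add, map_add, hx, hy, map_add, mul_add]
  | tmul b t => simp

lemma apply_integrate (I : T →ₗ[O] O) (φ : A →ₐ[O] B) (z : A ⊗[O] T) :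
    φ (integrate I A z) = integrate I B (Algebra.TensorProduct.map φ (AlgHom.id O T) z) := by
  induction z with
  | zero => simp
  | add x y hx hy => simp only [map_add, hx, hy]
  | tmul b t => simp

end Integrate

section Reynolds

variable {O H T A B : Type u} [CommRing O] [CommRing H] [HopfAlgebra O H] [CommRing T]
  [HopfAlgebra O T] [CommRing A] [Algebra O A] [CommRing B] [Algebra O B]

lemma apply_evalAt (φ : A →ₐ[O] B) {n : ℕ} (g : Fin n → Pt O H A) (f : Coord O H n) :
    φ (evalAt g f) = evalAt (fun i => Pt.map φ (g i)) f :=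
  DFunLike.congr_fun (comp_evalAt φ g) f

variable (T) in
/-- A point with values in `A`, regarded as a point with values in `A ⊗ T`. -/
def Pt.extend : Pt O H A →* Pt O H (A ⊗[O] T) :=
  Pt.map (Algebra.TensorProduct.includeLeft (S := O))

variable (A) in
/-- Right translation of the functions on `Spec T` over `A` by the point `t`. -/
def translate (t : Pt O T A) : A ⊗[O] T →ₐ[O] A ⊗[O] T :=
  Algebra.TensorProduct.lift (Algebra.TensorProduct.includeLeft (S := O))
    (toConv Algebra.TensorProduct.includeRight *
      Pt.extend T t : Pt O T (A ⊗[O] T)).ofConv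
    (fun _ _ => Commute.all _ _)

lemma translate_tmul (t : Pt O T A) (a : A) (x : T) :
    translate A t (a ⊗ₜ x) = a ⊗ₜ 1 * (toConv Algebra.TensorProduct.includeRight *
      Pt.extend T t : Pt O T (A ⊗[O] T)).ofConv x :=
  Algebra.TensorProduct.lift_tmul ..

lemma IsHaar.integrate_translate {I : T →ₗ[O] O} (hI : IsHaar I) (t : Pt O T A)
    (z : A ⊗[O] T) : integrate I A (translate A t z) = integrate I A z := by
  have integrate_lift : ∀ w : T ⊗[O] T, integrate I A (Algebra.TensorProduct.lift
      (Algebra.TensorProduct.includeRight (R := O) (A := A) (B := T))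
      (Pt.extend T t).ofConv
      (fun _ _ => Commute.all _ _) w) = t.ofConv (TensorProduct.lid O T (I.rTensor T w)) := by
    intro w
    induction w with
    | zero => simp
    | add x y hx hy => simp only [map_add, hx, hy]
    | tmul x y =>
      rw [Algebra.TensorProduct.lift_tmul]
      change integrate I A ((1 : A) ⊗ₜ[O] x * t.ofConv y ⊗ₜ[O] (1 : T)) = _
      simp
  induction z with
  | zero => simp
  | add x y hx hy => simp only [map_add, hx, hy]
  | tmul a x =>
    rw [translate_tmul, integrate_tmul_one_mul, AlgHom.convMul_apply]
    refine (congrArg (a * ·) (integrate_lift _)).trans ?_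
    simp [hI.rTensor_comul]

variable {q : H →ₐc[O] T} {I : T →ₗ[O] O}

/-- The universal point of `Spec T`, regarded as a point of `Spec H` with values in `A ⊗ T`. -/
def torusPt (q : H →ₐc[O] T) (A : Type u) [CommRing A] [Algebra O A] : Pt O H (A ⊗[O] T) :=
  Pt.push q (toConv Algebra.TensorProduct.includeRight)

lemma map_torusPt (q : H →ₐc[O] T) (φ : A →ₐ[O] B) :
    Pt.map (Algebra.TensorProduct.map φ (AlgHom.id O T)) (torusPt q A) = torusPt q B := by
  refine WithConv.ext (AlgHom.ext fun x => ?_)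
  change Algebra.TensorProduct.map φ (AlgHom.id O T) (1 ⊗ₜ q x) = 1 ⊗ₜ q x
  simp

lemma map_translate_torusPt (q : H →ₐc[O] T) (t : Pt O T A) :
    Pt.map (translate A t) (torusPt q A) =
      torusPt q A * Pt.extend T (Pt.push q t) := by
  have map_translate_includeRight : Pt.map (translate A t)
      (toConv (Algebra.TensorProduct.includeRight (R := O) (A := A) (B := T))) =
      toConv Algebra.TensorProduct.includeRight * Pt.extend T t := by
    refine WithConv.ext (AlgHom.ext fun x => (translate_tmul t 1 x).trans ?_)
    rw [← Algebra.TensorProduct.one_def, one_mul]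
  exact (congrArg (Pt.push q) map_translate_includeRight).trans (map_mul _ _ _)

/-- The conjugate of a point of `Spec H` by the universal point of `Spec T`. -/
def torusConj (q : H →ₐc[O] T) : Pt O H A →* Pt O H (A ⊗[O] T) :=
  (MulAut.conj (torusPt q A)).toMonoidHom.comp (Pt.extend T)

lemma torusConj_apply (q : H →ₐc[O] T) (g : Pt O H A) : torusConj q g =
    torusPt q A * Pt.extend T g * (torusPt q A)⁻¹ := rfl

lemma map_torusConj (q : H →ₐc[O] T) (φ : A →ₐ[O] B) (g : Pt O H A) :
    Pt.map (Algebra.TensorProduct.map φ (AlgHom.id O T)) (torusConj q g) =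
      torusConj q (Pt.map φ g) := by
  have map_extend : Pt.map (Algebra.TensorProduct.map φ (AlgHom.id O T))
      (Pt.extend T g) =
        Pt.extend T (Pt.map φ g) :=
    congrArg (fun ψ : A →ₐ[O] B ⊗[O] T => Pt.map ψ g)
      (Algebra.TensorProduct.map_comp_includeLeft φ (AlgHom.id O T))
  rw [torusConj_apply, torusConj_apply, map_mul, map_mul, map_inv, map_torusPt, map_extend]

lemma map_translate_torusConj (q : H →ₐc[O] T) (t : Pt O T A) (g : Pt O H A) :
    Pt.map (translate A t) (torusConj q g) =
      torusConj q (Pt.push q t * g * (Pt.push q t)⁻¹) := by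
  have map_extend : Pt.map (translate A t) (Pt.extend T g) = Pt.extend T g :=
    congrArg (fun ψ : A →ₐ[O] A ⊗[O] T => Pt.map ψ g)
      (Algebra.TensorProduct.lift_comp_includeLeft _ _ (fun _ _ => Commute.all _ _))
  rw [torusConj_apply, torusConj_apply, map_mul, map_mul, map_inv, map_translate_torusPt,
    map_extend, map_mul, map_mul, map_inv]
  group

/-- The Reynolds operator: a function on `Gⁿ` is averaged over its conjugates by `Spec T`. -/
def reynolds (q : H →ₐc[O] T) (I : T →ₗ[O] O) (n : ℕ) : Coord O H n →ₗ[O] Coord O H n :=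
  integrate I (Coord O H n) ∘ₗ (evalAt fun i => torusConj q (coordPt i)).toLinearMap

lemma evalAt_reynolds {n : ℕ} (g : Fin n → Pt O H A) (f : Coord O H n) :
    evalAt g (reynolds q I n f) = integrate I A (evalAt (fun i => torusConj q (g i)) f) := by
  refine (apply_integrate I (evalAt g) _).trans ?_
  simp only [AlgHom.toLinearMap_apply, apply_evalAt, map_torusConj, map_evalAt_coordPt]

lemma reynolds_reindexHom {m n : ℕ} (ζ : Fin m → Fin n) (f : Coord O H m) :
    reynolds q I n (reindexHom ζ f) = reindexHom ζ (reynolds q I m f) :=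
  coord_ext fun A _ _ g => by
    simp only [evalAt_reynolds, evalAt_reindexHom]

lemma reynolds_hatHom {n : ℕ} (f : Coord O H (n + 1)) :
    reynolds q I (n + 2) (hatHom n f) = hatHom n (reynolds q I (n + 1) f) :=
  coord_ext fun A _ _ g => by
    rw [evalAt_reynolds, evalAt_hatHom, evalAt_hatHom, evalAt_reynolds]
    congr 3
    funext i
    exact (map_mulLast (torusConj q) g i).symm

/-- The homomorphism `Spec T → Spec H` given by `q` maps onto the neutral component, on points. -/
def IsOntoNeutral (q : H →ₐc[O] T) : Prop :=
  ∀ (A : Type u) [CommRing A] [Algebra O A],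
    Set.range (Pt.push q : Pt O T A →* Pt O H A) = neutralPt A

lemma IsOntoNeutral.torusPt_mem (hq : IsOntoNeutral q) : torusPt q A ∈ neutralPt (A ⊗[O] T) :=
  hq (A ⊗[O] T) ▸ ⟨_, rfl⟩

lemma IsOntoNeutral.evalAt_torusConj (hq : IsOntoNeutral q) {n : ℕ} {f : Coord O H n}
    (hf : f ∈ invariants O H n) (g : Fin n → Pt O H A) :
    evalAt (fun i => torusConj q (g i)) f = evalAt g f ⊗ₜ 1 :=
  (hf _ _ hq.torusPt_mem _).trans
    (apply_evalAt (Algebra.TensorProduct.includeLeft (S := O) (A := A) (B := T)) g f).symm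

lemma IsOntoNeutral.reynolds_mul (hq : IsOntoNeutral q) {n : ℕ} {w : Coord O H n}
    (hw : w ∈ invariants O H n) (f : Coord O H n) :
    reynolds q I n (w * f) = w * reynolds q I n f :=
  coord_ext fun A _ _ g => by
    simp only [map_mul, evalAt_reynolds, hq.evalAt_torusConj hw, integrate_tmul_one_mul]

lemma IsOntoNeutral.reynolds_eq_self (hq : IsOntoNeutral q) (hI : IsHaar I) {n : ℕ}
    {f : Coord O H n} (hf : f ∈ invariants O H n) : reynolds q I n f = f :=
  coord_ext fun A _ _ g => by
    rw [evalAt_reynolds, hq.evalAt_torusConj hf, integrate_tmul, hI.map_one, one_smul]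

lemma IsOntoNeutral.reynolds_mem (hq : IsOntoNeutral q) (hI : IsHaar I) {n : ℕ}
    (f : Coord O H n) : reynolds q I n f ∈ invariants O H n := by
  intro A _ _ h hh g
  rw [← hq] at hh
  obtain ⟨t, rfl⟩ := hh
  simp only [evalAt_reynolds, ← map_translate_torusConj, ← apply_evalAt, hI.integrate_translate]

/-- The Reynolds operator as a map onto the invariant functions. -/
def reynoldsHom (hq : IsOntoNeutral q) (hI : IsHaar I) (n : ℕ) :
    Coord O H n →ₗ[O] invariants O H n :=
  (reynolds q I n).codRestrict (Subalgebra.toSubmodule (invariants O H n)) (hq.reynolds_mem hI)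

end Reynolds

/-! ### The universal family of points -/

section Family

open CategoryTheory Limits

variable (O H Γ : Type u) [CommRing O] [CommRing H] [HopfAlgebra O H]

/-- The coordinate ring of the product of copies of `Spec H` indexed by `Γ`: it carries the
universal family of points `familyPt`. -/
def FamilyRing : CommAlgCat.{u} O :=
  ∐ fun _ : Γ => CommAlgCat.of O H

variable {O H Γ} {A : Type u} [CommRing A] [Algebra O A]

/-- The universal family of points of `Spec H` indexed by `Γ`. -/
def familyPt (γ : Γ) : Pt O H (FamilyRing O H Γ) :=
  toConv (Sigma.ι (fun _ : Γ => CommAlgCat.of O H) γ).hom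

/-- The homomorphism out of `FamilyRing` classifying a family of points. -/
def familyLift (g : Γ → Pt O H A) : FamilyRing O H Γ →ₐ[O] A :=
  (Sigma.desc fun γ => CommAlgCat.ofHom (g γ).ofConv : FamilyRing O H Γ ⟶ CommAlgCat.of O A).hom

@[simp]
lemma map_familyLift (g : Γ → Pt O H A) (γ : Γ) : Pt.map (familyLift g) (familyPt γ) = g γ :=
  congrArg (fun φ => toConv φ.hom)
    (Sigma.ι_desc (fun γ => CommAlgCat.ofHom (g γ).ofConv) γ)

lemma family_hom_ext {φ ψ : FamilyRing O H Γ →ₐ[O] A}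
    (h : ∀ γ, Pt.map φ (familyPt γ) = Pt.map ψ (familyPt γ)) : φ = ψ :=
  congrArg CommAlgCat.Hom.hom (Sigma.hom_ext (CommAlgCat.ofHom φ) (CommAlgCat.ofHom ψ)
    fun γ => CommAlgCat.hom_ext (congrArg ofConv (h γ)))

lemma familyLift_evalAt (g : Γ → Pt O H A) {n : ℕ} (γ : Fin n → Γ) (f : Coord O H n) :
    familyLift g (evalAt (fun i => familyPt (γ i)) f) = evalAt (fun i => g (γ i)) f := by
  simp only [apply_evalAt, map_familyLift]

lemma evalAt_coordPt (n : ℕ) : evalAt (coordPt (O := O) (H := H) (n := n)) = AlgHom.id O _ :=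
  PiTensorProduct.algHom_ext fun i => evalAt_single coordPt i

lemma exists_common_tuple (g : Γ → Pt O H A) {a b : A}
    (ha : ∃ (n : ℕ) (γ : Fin (n + 1) → Γ) (f : Coord O H (n + 1)),
      evalAt (fun i => g (γ i)) f = a)
    (hb : ∃ (n : ℕ) (γ : Fin (n + 1) → Γ) (f : Coord O H (n + 1)),
      evalAt (fun i => g (γ i)) f = b) :
    ∃ (n : ℕ) (γ : Fin (n + 1) → Γ) (f f' : Coord O H (n + 1)),
      evalAt (fun i => g (γ i)) f = a ∧ evalAt (fun i => g (γ i)) f' = b := by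
  obtain ⟨m, γ, f, rfl⟩ := ha
  obtain ⟨n, δ, f', rfl⟩ := hb
  exact ⟨m + 1 + n, Fin.append (m := m + 1) (n := n + 1) γ δ, reindexHom (Fin.castAdd (n + 1)) f,
    reindexHom (Fin.natAdd (m + 1)) f', by simp [evalAt_reindexHom], by simp [evalAt_reindexHom]⟩

/-- The subalgebra of values of functions on finite powers of `Spec H` at tuples from a family. -/
def valueSubalgebra [Nonempty Γ] (g : Γ → Pt O H A) : Subalgebra O A where
  carrier := {a | ∃ (n : ℕ) (γ : Fin (n + 1) → Γ) (f : Coord O H (n + 1)),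
    evalAt (fun i => g (γ i)) f = a}
  mul_mem' ha hb := by
    obtain ⟨n, γ, f, f', rfl, rfl⟩ := exists_common_tuple g ha hb
    exact ⟨n, γ, f * f', map_mul _ _ _⟩
  add_mem' ha hb := by
    obtain ⟨n, γ, f, f', rfl, rfl⟩ := exists_common_tuple g ha hb
    exact ⟨n, γ, f + f', map_add _ _ _⟩
  algebraMap_mem' c := ⟨0, fun _ => Classical.arbitrary Γ, algebraMap O _ c, AlgHom.commutes _ c⟩

lemma apply_mem_valueSubalgebra [Nonempty Γ] (g : Γ → Pt O H A) (γ : Γ) (h : H) :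
    (g γ).ofConv h ∈ valueSubalgebra g :=
  ⟨0, fun _ => γ, (coordPt 0 : Pt O H (Coord O H 1)).ofConv h,
    congrArg (fun x : Pt O H A => x.ofConv h) (map_evalAt_coordPt (fun _ => g γ) 0)⟩

lemma exists_evalAt_familyPt [Nonempty Γ] (b : FamilyRing O H Γ) :
    ∃ (n : ℕ) (γ : Fin (n + 1) → Γ) (f : Coord O H (n + 1)),
      evalAt (fun i => familyPt (γ i)) f = b := by
  let S : Subalgebra O (FamilyRing O H Γ) := valueSubalgebra familyPt
  let g : Γ → Pt O H S := fun γ =>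
    toConv ((familyPt γ).ofConv.codRestrict S (apply_mem_valueSubalgebra familyPt γ))
  have val_comp_lift : S.val.comp (familyLift g) = AlgHom.id O _ :=
    family_hom_ext fun γ => congrArg (Pt.map S.val) (map_familyLift g γ)
  rw [← AlgHom.id_apply (R := O) b, ← val_comp_lift]
  exact (familyLift g b).2

lemma evalAt_familyPt_injective {n : ℕ} {γ : Fin n → Γ} (hγ : Function.Injective γ) :
    Function.Injective (evalAt (O := O) (H := H) fun i => familyPt (γ i)) := by
  let g : Γ → Pt O H (Coord O H n) := Function.extend γ coordPt 1
  have g_apply : ∀ i, g (γ i) = coordPt i := hγ.extend_apply coordPt 1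
  refine Function.LeftInverse.injective (g := familyLift g) fun f => ?_
  simp only [familyLift_evalAt, g_apply, evalAt_coordPt, AlgHom.id_apply]

lemma exists_injective_tuple {m n : ℕ} (γ : Fin (m + 1) → Γ) (δ : Fin (n + 1) → Γ) :
    ∃ (k : ℕ) (ε : Fin (k + 1) → Γ) (ζ : Fin (m + 1) → Fin (k + 1))
      (ξ : Fin (n + 1) → Fin (k + 1)), Function.Injective ε ∧
        (∀ i, ε (ζ i) = γ i) ∧ ∀ i, ε (ξ i) = δ i := by
  classical
  let s : Finset Γ := Finset.univ.image γ ∪ Finset.univ.image δ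
  have hγ : ∀ i, γ i ∈ s := fun i =>
    Finset.mem_union_left _ (Finset.mem_image_of_mem _ (Finset.mem_univ i))
  have hδ : ∀ i, δ i ∈ s := fun i =>
    Finset.mem_union_right _ (Finset.mem_image_of_mem _ (Finset.mem_univ i))
  obtain ⟨k, hk⟩ := Nat.exists_eq_succ_of_ne_zero (Finset.card_ne_zero_of_mem (hγ 0))
  let e := s.equivFinOfCardEq hk
  exact ⟨k, fun i => (e.symm i).1, fun i => e ⟨γ i, hγ i⟩, fun i => e ⟨δ i, hδ i⟩,
    Subtype.val_injective.comp e.symm.injective, fun i => by simp, fun i => by simp⟩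

section Functional

variable {M : Type*} [AddCommGroup M] [Module O M]
  {Λ : ∀ n : ℕ, (Fin (n + 1) → Γ) → Coord O H (n + 1) →ₗ[O] M}
  (hΛ : ∀ (m n : ℕ) (ζ : Fin (m + 1) → Fin (n + 1)) (f : Coord O H (m + 1))
    (γ : Fin (n + 1) → Γ), Λ n γ (reindexHom ζ f) = Λ m (fun j => γ (ζ j)) f)

include hΛ

lemma functional_eq_of_evalAt_familyPt_eq {m n : ℕ} {γ : Fin (m + 1) → Γ}
    {f : Coord O H (m + 1)} {δ : Fin (n + 1) → Γ} {f' : Coord O H (n + 1)}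
    (h : evalAt (fun i => familyPt (γ i)) f = evalAt (fun i => familyPt (δ i)) f') :
    Λ m γ f = Λ n δ f' := by
  obtain ⟨k, ε, ζ, ξ, hε, hζ, hξ⟩ := exists_injective_tuple γ δ
  obtain rfl : (fun i => ε (ζ i)) = γ := funext hζ
  obtain rfl : (fun i => ε (ξ i)) = δ := funext hξ
  have reindexHom_eq : reindexHom ζ f = reindexHom ξ f' :=
    evalAt_familyPt_injective hε (by simpa only [evalAt_reindexHom] using h)
  rw [← hΛ m k ζ, ← hΛ n k ξ, reindexHom_eq]

lemma exists_linearMap_evalAt_familyPt [Nonempty Γ] :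
    ∃ l : FamilyRing O H Γ →ₗ[O] M, ∀ (n : ℕ) (γ : Fin (n + 1) → Γ) (f : Coord O H (n + 1)),
      l (evalAt (fun i => familyPt (γ i)) f) = Λ n γ f := by
  choose n γ f hf using exists_evalAt_familyPt (O := O) (H := H) (Γ := Γ)
  let l : FamilyRing O H Γ → M := fun b => Λ (n b) (γ b) (f b)
  have hl : ∀ (n : ℕ) (γ : Fin (n + 1) → Γ) (f : Coord O H (n + 1)),
      l (evalAt (fun i => familyPt (γ i)) f) = Λ n γ f :=
    fun n γ f => functional_eq_of_evalAt_familyPt_eq hΛ (hf _)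
  refine ⟨⟨⟨l, fun a b => ?_⟩, fun c a => ?_⟩, hl⟩
  · obtain ⟨n, γ, f, f', rfl, rfl⟩ := exists_common_tuple familyPt
      (exists_evalAt_familyPt a) (exists_evalAt_familyPt b)
    rw [← map_add, hl, hl, hl, map_add]
  · obtain ⟨n, γ, f, rfl⟩ := exists_evalAt_familyPt a
    change l _ = c • l _
    rw [← map_smul, hl, hl, map_smul]

end Functional

end Family

/-! ### Representations and pseudocharacters subject to conditions -/

section Moduli

variable {O H Γ : Type u} [CommRing O] [CommRing H] [HopfAlgebra O H] [Group Γ]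
  {A B : Type u} [CommRing A] [Algebra O A] [CommRing B] [Algebra O B]

variable (O H Γ) in
/-- The condition `Θₙ₊₁(f)(γ) = c` on a pseudocharacter `Θ`. Sets of such conditions cut out the
admissible loci. -/
structure Condition where
  n : ℕ
  f : invariants O H (n + 1)
  γ : Fin (n + 1) → Γ
  c : O

/-- The pseudocharacter `T` satisfies all conditions in `W`. -/
def PseudoChar.Satisfies (T : PseudoChar O H Γ A) (W : Set (Condition O H Γ)) : Prop :=
  ∀ w ∈ W, T.Θ w.n w.f w.γ = algebraMap O A w.c

/-- `(R, ρ)` represents the functor of representations whose pseudocharacter satisfies `W`. -/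
def IsUniversalRepWith (W : Set (Condition O H Γ)) (ρ : Γ →* Pt O H A) : Prop :=
  (PseudoChar.ofRep ρ).Satisfies W ∧
  ∀ (B : Type u) [CommRing B] [Algebra O B] (σ : Γ →* Pt O H B),
    (PseudoChar.ofRep σ).Satisfies W → ∃! φ : A →ₐ[O] B, (Pt.map φ).comp ρ = σ

/-- `(P, T)` represents the functor of pseudocharacters satisfying `W`. -/
def IsUniversalPseudoCharWith (W : Set (Condition O H Γ)) (T : PseudoChar O H Γ A) : Prop :=
  T.Satisfies W ∧
  ∀ (B : Type u) [CommRing B] [Algebra O B] (S : PseudoChar O H Γ B),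
    S.Satisfies W → ∃! φ : A →ₐ[O] B, T.map φ = S

variable {W : Set (Condition O H Γ)}

lemma IsUniversalPseudoCharWith.exists_algEquiv {T : PseudoChar O H Γ A} {S : PseudoChar O H Γ B}
    (hT : IsUniversalPseudoCharWith W T) (hS : IsUniversalPseudoCharWith W S) :
    ∃ e : A ≃ₐ[O] B, T.map e.toAlgHom = S := by
  obtain ⟨φ, hφ, -⟩ := hT.2 B S hS.1
  obtain ⟨ψ, hψ, -⟩ := hS.2 A T hT.1
  have comp_eq_id : φ.comp ψ = AlgHom.id O B :=
    (hS.2 B S hS.1).unique ((congrArg (PseudoChar.map φ) hψ).trans hφ) rfl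
  have comp_eq_id' : ψ.comp φ = AlgHom.id O A :=
    (hT.2 A T hT.1).unique ((congrArg (PseudoChar.map ψ) hφ).trans hψ) rfl
  exact ⟨AlgEquiv.ofAlgHom φ ψ comp_eq_id comp_eq_id', hφ⟩

/-! ### The universal representation -/

variable (W) in
/-- The relations that make the universal family of points a representation satisfying `W`. -/
def repIdeal : Ideal (FamilyRing O H Γ) :=
  Ideal.span ({x | ∃ γ γ' h, x = (familyPt (γ * γ')).ofConv h -
      (familyPt γ * familyPt γ').ofConv h} ∪
    {x | ∃ w ∈ W, x = evalAt (fun i => familyPt (w.γ i)) w.f.1 - algebraMap O _ w.c})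

variable (W) in
/-- The universal representation satisfying `W`, over the quotient of `FamilyRing` by the
defining relations. -/
def univRep : Γ →* Pt O H (FamilyRing O H Γ ⧸ repIdeal W) :=
  MonoidHom.mk' (fun γ => Pt.map (Ideal.Quotient.mkₐ O (repIdeal W)) (familyPt γ)) fun γ γ' => by
    rw [← map_mul]
    exact WithConv.ext (AlgHom.ext fun h =>
      Ideal.Quotient.eq.mpr (Ideal.subset_span (Or.inl ⟨γ, γ', h, rfl⟩)))

lemma repIdeal_le_ker_familyLift {σ : Γ →* Pt O H A} (hσ : (PseudoChar.ofRep σ).Satisfies W) :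
    repIdeal W ≤ RingHom.ker (familyLift σ) := by
  refine Ideal.span_le.mpr ?_
  rintro _ (⟨γ, γ', h, rfl⟩ | ⟨w, hw, rfl⟩) <;>
    rw [SetLike.mem_coe, RingHom.mem_ker, map_sub, sub_eq_zero]
  · have map_mul_eq : Pt.map (familyLift σ) (familyPt (γ * γ')) =
        Pt.map (familyLift σ) (familyPt γ * familyPt γ') := by
      simp only [map_mul, map_familyLift]
    exact congrArg (fun g : Pt O H A => g.ofConv h) map_mul_eq
  · rw [familyLift_evalAt, AlgHom.commutes]
    exact hσ w hw

theorem isUniversalRepWith_univRep : IsUniversalRepWith W (univRep W) := by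
  refine ⟨fun w hw => ?_, fun A _ _ σ hσ => ?_⟩
  · refine (apply_evalAt (Ideal.Quotient.mkₐ O (repIdeal W)) _ _).symm.trans ?_
    exact Ideal.Quotient.eq.mpr (Ideal.subset_span (Or.inr ⟨w, hw, rfl⟩))
  · refine ⟨Ideal.Quotient.liftₐ (repIdeal W) (familyLift σ)
      fun x hx => repIdeal_le_ker_familyLift hσ hx, ?_, ?_⟩
    · exact MonoidHom.ext fun γ => map_familyLift σ γ
    · rintro ψ rfl
      refine Ideal.Quotient.algHom_ext _ (family_hom_ext fun γ => ?_)
      exact (map_familyLift (fun δ => Pt.map ψ (univRep W δ)) γ).symm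

variable {R : Type u} [CommRing R] [Algebra O R] {ρ : Γ →* Pt O H R}

lemma IsUniversalRepWith.exists_comp_familyLift (hρ : IsUniversalRepWith W ρ)
    {σ : Γ →* Pt O H A} (hσ : (PseudoChar.ofRep σ).Satisfies W) :
    ∃ φ : R →ₐ[O] A, φ.comp (familyLift ρ) = familyLift σ := by
  obtain ⟨φ, rfl, -⟩ := hρ.2 A σ hσ
  refine ⟨φ, family_hom_ext fun γ => ?_⟩
  rw [map_familyLift]
  exact congrArg (Pt.map φ) (map_familyLift ρ γ)

lemma familyLift_univRep : familyLift (univRep W) = Ideal.Quotient.mkₐ O (repIdeal W) :=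
  family_hom_ext fun γ => map_familyLift (univRep W) γ

lemma IsUniversalRepWith.ker_familyLift (hρ : IsUniversalRepWith W ρ) :
    RingHom.ker (familyLift ρ) = repIdeal W := by
  refine le_antisymm (fun x hx => ?_) (repIdeal_le_ker_familyLift hρ.1)
  obtain ⟨φ, hφ⟩ := hρ.exists_comp_familyLift (isUniversalRepWith_univRep (W := W)).1
  rw [familyLift_univRep] at hφ
  refine Ideal.Quotient.eq_zero_iff_mem.mp ((DFunLike.congr_fun hφ x).symm.trans ?_)
  rw [AlgHom.comp_apply, RingHom.mem_ker.mp hx, map_zero]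

lemma IsUniversalRepWith.familyLift_surjective (hρ : IsUniversalRepWith W ρ) :
    Function.Surjective (familyLift ρ) := by
  obtain ⟨φ, hφ, -⟩ := hρ.2 _ (univRep W) isUniversalRepWith_univRep.1
  obtain ⟨ψ, hψ, -⟩ := isUniversalRepWith_univRep.2 R ρ hρ.1
  have comp_eq_id : ψ.comp φ = AlgHom.id O R :=
    (hρ.2 R ρ hρ.1).unique ((congrArg (Pt.map ψ).comp hφ).trans hψ) rfl
  have familyLift_eq : familyLift ρ = ψ.comp (Ideal.Quotient.mkₐ O (repIdeal W)) := by
    rw [← hψ]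
    exact family_hom_ext fun γ => map_familyLift _ γ
  rw [familyLift_eq]
  have surjective_ψ : Function.Surjective ψ :=
    Function.RightInverse.surjective (DFunLike.congr_fun comp_eq_id)
  exact surjective_ψ.comp (Ideal.Quotient.mkₐ_surjective O (repIdeal W))

lemma IsUniversalRepWith.exists_evalAt (hρ : IsUniversalRepWith W ρ) (r : R) :
    ∃ (n : ℕ) (γ : Fin (n + 1) → Γ) (f : Coord O H (n + 1)),
      evalAt (fun i => ρ (γ i)) f = r := by
  obtain ⟨b, rfl⟩ := hρ.familyLift_surjective r
  obtain ⟨n, γ, f, rfl⟩ := exists_evalAt_familyPt b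
  exact ⟨n, γ, f, (familyLift_evalAt ρ γ f).symm⟩

/-! ### The average of a pseudocharacter -/

section Average

variable {T : Type u} [CommRing T] [HopfAlgebra O T] {q : H →ₐc[O] T} {I : T →ₗ[O] O}
  (hq : IsOntoNeutral q) (hI : IsHaar I) (S : PseudoChar O H Γ A)

lemma exists_average : ∃ l : FamilyRing O H Γ →ₗ[O] A,
    ∀ (n : ℕ) (γ : Fin (n + 1) → Γ) (f : Coord O H (n + 1)),
      l (evalAt (fun i => familyPt (γ i)) f) = S.Θ n (reynoldsHom hq hI (n + 1) f) γ := by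
  let Λ (n : ℕ) (γ : Fin (n + 1) → Γ) : Coord O H (n + 1) →ₗ[O] A :=
    LinearMap.proj γ ∘ₗ (S.Θ n).toLinearMap ∘ₗ reynoldsHom hq hI (n + 1)
  refine exists_linearMap_evalAt_familyPt (Λ := Λ) fun m n ζ f γ => ?_
  refine Eq.trans ?_ (S.reindex m n ζ (reynoldsHom hq hI (m + 1) f) γ)
  exact congrArg (fun x => S.Θ n x γ) (Subtype.ext (reynolds_reindexHom ζ f))

/-- The composite of a pseudocharacter with the Reynolds operator, as a functional on the
coordinate ring of the scheme of families of points. -/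
def PseudoChar.average : FamilyRing O H Γ →ₗ[O] A :=
  (exists_average hq hI S).choose

lemma PseudoChar.average_evalAt {n : ℕ} (γ : Fin (n + 1) → Γ) (f : Coord O H (n + 1)) :
    S.average hq hI (evalAt (fun i => familyPt (γ i)) f) =
      S.Θ n (reynoldsHom hq hI (n + 1) f) γ :=
  (exists_average hq hI S).choose_spec n γ f

lemma PseudoChar.average_one : S.average hq hI 1 = 1 := by
  have reynoldsHom_one : reynoldsHom hq hI 1 1 = 1 :=
    Subtype.ext (hq.reynolds_eq_self hI (one_mem _))
  have h := S.average_evalAt hq hI (fun _ => 1) (1 : Coord O H 1)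
  rwa [map_one (evalAt _), reynoldsHom_one, map_one (S.Θ 0)] at h

lemma PseudoChar.average_mul_evalAt (b : FamilyRing O H Γ) {n : ℕ} (v : invariants O H (n + 1))
    (δ : Fin (n + 1) → Γ) :
    S.average hq hI (b * evalAt (fun i => familyPt (δ i)) v.1) =
      S.average hq hI b * S.Θ n v δ := by
  obtain ⟨m, γ, f, rfl⟩ := exists_evalAt_familyPt b
  let left : Fin (m + 1) → Fin (m + 1 + n + 1) := Fin.castAdd (n + 1)
  let right : Fin (n + 1) → Fin (m + 1 + n + 1) := Fin.natAdd (m + 1)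
  let ε : Fin (m + 1 + n + 1) → Γ := Fin.append (m := m + 1) (n := n + 1) γ δ
  have ε_left : (fun i => ε (left i)) = γ := funext (Fin.append_left γ δ)
  have ε_right : (fun i => ε (right i)) = δ := funext (Fin.append_right γ δ)
  have mul_eq : evalAt (fun i => familyPt (γ i)) f * evalAt (fun i => familyPt (δ i)) v.1 =
      evalAt (fun i => familyPt (ε i)) (reindexHom right v.1 * reindexHom left f) := by
    rw [map_mul, evalAt_reindexHom, evalAt_reindexHom, mul_comm, ← ε_left, ← ε_right]
  have reynoldsHom_mul : reynoldsHom hq hI (m + 1 + n + 1)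
      (reindexHom right v.1 * reindexHom left f) =
      ⟨reindexHom right v.1, reindexHom_mem right v.2⟩ *
        ⟨reindexHom left (reynoldsHom hq hI (m + 1) f).1, reindexHom_mem left (Subtype.prop _)⟩ :=
    Subtype.ext ((hq.reynolds_mul (reindexHom_mem right v.2) _).trans
      (congrArg _ (reynolds_reindexHom left f)))
  rw [mul_eq, S.average_evalAt, S.average_evalAt, reynoldsHom_mul, map_mul, Pi.mul_apply,
    S.reindex, S.reindex, ε_left, ε_right, mul_comm]

lemma exists_evalAt_eq_mul_last {n : ℕ} (f : Coord O H n) (h : H) :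
    ∃ F : Coord O H (n + 1), ∀ {A : Type u} [CommRing A] [Algebra O A]
      (g : Fin (n + 1) → Pt O H A),
        evalAt g F = evalAt (fun i => g i.castSucc) f * (g (Fin.last n)).ofConv h := by
  refine ⟨reindexHom Fin.castSucc f * (coordPt (O := O) (H := H) (Fin.last n)).ofConv h,
    fun g => ?_⟩
  rw [map_mul, evalAt_reindexHom]
  exact congrArg (fun x : Pt O H _ => _ * x.ofConv h) (map_evalAt_coordPt g (Fin.last n))

lemma PseudoChar.average_mul_familyPt_mul (b : FamilyRing O H Γ) (γ γ' : Γ) (h : H) :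
    S.average hq hI (b * (familyPt (γ * γ')).ofConv h) =
      S.average hq hI (b * (familyPt γ * familyPt γ').ofConv h) := by
  obtain ⟨n, δ, f, rfl⟩ := exists_evalAt_familyPt b
  obtain ⟨F, evalAt_F⟩ := exists_evalAt_eq_mul_last f h
  let ε : Fin (n + 1 + 2) → Γ := Fin.snoc (α := fun _ => Γ) (Fin.snoc (α := fun _ => Γ) δ γ) γ'
  have mul_left : evalAt (fun i => familyPt (δ i)) f * (familyPt (γ * γ')).ofConv h =
      evalAt (fun i => familyPt (mulLast ε i)) F := by
    rw [evalAt_F]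
    simp [ε, mulLast]
  have mul_right : evalAt (fun i => familyPt (δ i)) f * (familyPt γ * familyPt γ').ofConv h =
      evalAt (fun i => familyPt (ε i)) (hatHom (n + 1) F) := by
    rw [evalAt_hatHom, evalAt_F]
    simp [ε, mulLast]
  rw [mul_left, mul_right, S.average_evalAt, S.average_evalAt, ← S.hat]
  exact congrArg (fun x => S.Θ _ x ε) (Subtype.ext (reynolds_hatHom F).symm)

variable {S} in
lemma PseudoChar.Satisfies.average_eq_zero (hS : S.Satisfies W) {x : FamilyRing O H Γ}
    (hx : x ∈ repIdeal W) : S.average hq hI x = 0 := by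
  suffices average_mul_eq_zero : ∀ b, S.average hq hI (b * x) = 0 by
    simpa only [one_mul] using average_mul_eq_zero 1
  refine Submodule.span_induction ?_ (fun b => by simp)
    (fun x y _ _ hx hy b => by rw [mul_add, map_add, hx, hy, add_zero])
    (fun a x _ hx b => by rw [smul_eq_mul, ← mul_assoc, hx]) hx
  rintro _ (⟨γ, γ', h, rfl⟩ | ⟨w, hw, rfl⟩) b <;> rw [mul_sub, map_sub, sub_eq_zero]
  · exact S.average_mul_familyPt_mul hq hI b γ γ' h
  · rw [S.average_mul_evalAt, hS w hw, mul_comm b, ← Algebra.smul_def, map_smul, Algebra.smul_def,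
      mul_comm]

variable {S} in
lemma IsUniversalRepWith.exists_average (hρ : IsUniversalRepWith W ρ) (hS : S.Satisfies W) :
    ∃ l : R →ₗ[O] A, ∀ b, l (familyLift ρ b) = S.average hq hI b := by
  let p := (familyLift ρ).toLinearMap
  let e := p.quotKerEquivOfSurjective hρ.familyLift_surjective
  have ker_le : LinearMap.ker p ≤ LinearMap.ker (S.average hq hI) := fun x hx =>
    hS.average_eq_zero hq hI (hρ.ker_familyLift ▸ hx)
  refine ⟨(LinearMap.ker p).liftQ _ ker_le ∘ₗ e.symm.toLinearMap, fun b => ?_⟩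
  have symm_apply : e.symm (familyLift ρ b) = Submodule.Quotient.mk b :=
    (LinearEquiv.symm_apply_eq e).mpr rfl
  rw [LinearMap.comp_apply, LinearEquiv.coe_coe, symm_apply]
  rfl

end Average

end Moduli

/-! ### The comparison -/

section Comparison

variable {O H Γ : Type u} [CommRing O] [CommRing H] [HopfAlgebra O H] [Group Γ]
  {R A : Type u} [CommRing R] [Algebra O R] [CommRing A] [Algebra O A] {ρ : Γ →* Pt O H R}

lemma evalAt_mem_repInvariants (ρ : Γ →* Pt O H R) {n : ℕ} (γ : Fin n → Γ) {f : Coord O H n}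
    (hf : f ∈ invariants O H n) : evalAt (fun i => ρ (γ i)) f ∈ repInvariants ρ := by
  intro A _ _ h hh φ φ' hφ
  simp only [apply_evalAt, hφ]
  exact hf A h hh _

/-- The pseudocharacter of `ρ`, with values in the ring of invariants. -/
def invPseudoChar (ρ : Γ →* Pt O H R) : PseudoChar O H Γ (repInvariants ρ) where
  Θ n := AlgHom.pi fun γ => ((evalAt fun i => ρ (γ i)).comp
    (invariants O H (n + 1)).val).codRestrict (repInvariants ρ)
      fun f => evalAt_mem_repInvariants ρ γ f.2
  reindex m n ζ f γ := Subtype.ext ((PseudoChar.ofRep ρ).reindex m n ζ f γ)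
  hat n f γ := Subtype.ext ((PseudoChar.ofRep ρ).hat n f γ)

variable {W : Set (Condition O H Γ)} {T : Type u} [CommRing T] [HopfAlgebra O T]
  {q : H →ₐc[O] T} {I : T →ₗ[O] O}

lemma IsUniversalRepWith.exists_coaction (hρ : IsUniversalRepWith W ρ) (hq : IsOntoNeutral q) :
    ∃ φ : R →ₐ[O] R ⊗[O] T, ∀ γ, Pt.map φ (ρ γ) = torusConj q (ρ γ) := by
  have torusConj_satisfies : (PseudoChar.ofRep ((torusConj q).comp ρ)).Satisfies W := fun w hw =>
    (hq.evalAt_torusConj w.f.2 _).trans (congrArg (· ⊗ₜ[O] (1 : T)) (hρ.1 w hw))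
  obtain ⟨φ, hφ, -⟩ := hρ.2 _ _ torusConj_satisfies
  exact ⟨φ, DFunLike.congr_fun hφ⟩

lemma IsUniversalRepWith.evalAt_reynolds (hρ : IsUniversalRepWith W ρ) (hq : IsOntoNeutral q)
    (hI : IsHaar I) {n : ℕ} {γ : Fin n → Γ} {f : Coord O H n}
    (hf : evalAt (fun i => ρ (γ i)) f ∈ repInvariants ρ) :
    evalAt (fun i => ρ (γ i)) (reynolds q I n f) = evalAt (fun i => ρ (γ i)) f := by
  obtain ⟨φ, hφ⟩ := hρ.exists_coaction hq
  have coaction_eq : φ (evalAt (fun i => ρ (γ i)) f) = evalAt (fun i => ρ (γ i)) f ⊗ₜ 1 :=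
    hf _ _ hq.torusPt_mem Algebra.TensorProduct.includeLeft φ hφ
  rw [apply_evalAt] at coaction_eq
  simp only [hφ] at coaction_eq
  rw [GenTorus.evalAt_reynolds, coaction_eq, integrate_tmul, hI.map_one, one_smul]

lemma IsUniversalRepWith.exists_invPseudoChar_apply (hρ : IsUniversalRepWith W ρ)
    (hq : IsOntoNeutral q) (hI : IsHaar I) (r : repInvariants ρ) :
    ∃ (n : ℕ) (f : invariants O H (n + 1)) (γ : Fin (n + 1) → Γ),
      (invPseudoChar ρ).Θ n f γ = r := by
  obtain ⟨r, hr⟩ := r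
  obtain ⟨n, γ, f, rfl⟩ := hρ.exists_evalAt r
  exact ⟨n, reynoldsHom hq hI (n + 1) f, γ, Subtype.ext (hρ.evalAt_reynolds hq hI hr)⟩

lemma IsUniversalRepWith.exists_invPseudoChar_map_eq (hρ : IsUniversalRepWith W ρ)
    (hq : IsOntoNeutral q) (hI : IsHaar I) {S : PseudoChar O H Γ A} (hS : S.Satisfies W) :
    ∃ φ : repInvariants ρ →ₐ[O] A, (invPseudoChar ρ).map φ = S := by
  obtain ⟨l, hl⟩ := hρ.exists_average hq hI hS
  have l_one : l 1 = 1 := by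
    rw [← map_one (familyLift ρ), hl, S.average_one]
  have l_mul : ∀ (r : R) {n : ℕ} (v : invariants O H (n + 1)) (δ : Fin (n + 1) → Γ),
      l (r * evalAt (fun i => ρ (δ i)) v.1) = l r * S.Θ n v δ := by
    intro r n v δ
    obtain ⟨b, rfl⟩ := hρ.familyLift_surjective r
    rw [← familyLift_evalAt, ← map_mul, hl, hl, S.average_mul_evalAt]
  have l_evalAt : ∀ {n : ℕ} (v : invariants O H (n + 1)) (δ : Fin (n + 1) → Γ),
      l (evalAt (fun i => ρ (δ i)) v.1) = S.Θ n v δ := by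
    intro n v δ
    simpa only [one_mul, l_one] using l_mul 1 v δ
  refine ⟨AlgHom.ofLinearMap (l ∘ₗ (repInvariants ρ).val.toLinearMap) l_one fun r s => ?_, ?_⟩
  · obtain ⟨n, v, δ, rfl⟩ := hρ.exists_invPseudoChar_apply hq hI s
    exact (l_mul r.1 v δ).trans (congrArg (l r.1 * ·) (l_evalAt v δ).symm)
  · exact PseudoChar.ext (funext fun n => AlgHom.ext fun v => funext fun δ => l_evalAt v δ)

theorem IsUniversalRepWith.isUniversalPseudoCharWith (hρ : IsUniversalRepWith W ρ)
    (hq : IsOntoNeutral q) (hI : IsHaar I) :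
    IsUniversalPseudoCharWith W (invPseudoChar ρ) := by
  refine ⟨fun w hw => Subtype.ext (hρ.1 w hw), fun A _ _ S hS => ?_⟩
  obtain ⟨φ, hφ⟩ := hρ.exists_invPseudoChar_map_eq hq hI hS
  refine ⟨φ, hφ, fun ψ hψ => AlgHom.ext fun r => ?_⟩
  obtain ⟨n, f, γ, rfl⟩ := hρ.exists_invPseudoChar_apply hq hI r
  exact congrArg (fun S : PseudoChar O H Γ A => S.Θ n f γ) (hψ.trans hφ.symm)

lemma isUniversalRepWith_empty_iff : IsUniversalRepWith ∅ ρ ↔ IsUniversalRep ρ := by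
  simp [IsUniversalRepWith, IsUniversalRep, PseudoChar.Satisfies]

lemma isUniversalPseudoCharWith_empty_iff {S : PseudoChar O H Γ A} :
    IsUniversalPseudoCharWith ∅ S ↔ IsUniversalPseudoChar S := by
  simp [IsUniversalPseudoCharWith, IsUniversalPseudoChar, PseudoChar.Satisfies]

end Comparison

/-! ### Admissibility -/

section Admissible

variable {O H Γ Δ : Type u} [CommRing O] [CommRing H] [HopfAlgebra O H] [Group Γ]
  [Group Δ] [Fintype Δ] [DecidableEq Δ] {A : Type u} [CommRing A] [Algebra O A]

lemma ConstCoord.ind_notMem_of_mem_neutralLocus {x : PrimeSpectrum (ConstCoord O Δ)}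
    (hx : x ∈ neutralLocus O (ConstCoord O Δ)) : ConstCoord.ind O (1 : Δ) ∉ x.asIdeal := by
  have isIdempotentElem_ind : IsIdempotentElem (ConstCoord.ind O (1 : Δ)) := by
    simp [IsIdempotentElem, ConstCoord.ind_mul_ind]
  have isClopen_basicOpen := PrimeSpectrum.isClopen_iff.mpr ⟨_, isIdempotentElem_ind, rfl⟩
  refine isPreconnected_connectedComponentIn.subset_isClopen isClopen_basicOpen
    ⟨_, mem_connectedComponentIn (connectedComponentIn_nonempty_iff.mp ⟨x, hx⟩), ?_⟩ hx
  have counit_ind : Bialgebra.counitAlgHom O (ConstCoord O Δ) (ConstCoord.ind O (1 : Δ)) = 1 :=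
    (ConstCoord.ev_ind 1 1).trans (if_pos rfl)
  change ¬ Bialgebra.counitAlgHom O (ConstCoord O Δ) (ConstCoord.ind O (1 : Δ)) ∈
    (PrimeSpectrum.comap (algebraMap O (ConstCoord O Δ)) x).asIdeal
  rw [counit_ind]
  exact (Ideal.ne_top_iff_one _).mp (PrimeSpectrum.isPrime _).ne_top

lemma ConstCoord.apply_ind_one_of_mem_neutralPt {g : Pt O (ConstCoord O Δ) A}
    (hg : g ∈ neutralPt A) : g.ofConv (ConstCoord.ind O (1 : Δ)) = 1 := by
  have isIdempotentElem_apply : IsIdempotentElem (g.ofConv (ConstCoord.ind O (1 : Δ))) := by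
    rw [IsIdempotentElem, ← map_mul, ConstCoord.ind_mul_ind, if_pos rfl]
  refine (IsIdempotentElem.iff_eq_one_of_isUnit ?_).mp isIdempotentElem_apply
  by_contra not_isUnit
  obtain ⟨M, hM, ind_mem⟩ := exists_max_ideal_of_mem_nonunits not_isUnit
  exact ConstCoord.ind_notMem_of_mem_neutralLocus (hg ⟨M, hM.isPrime⟩) ind_mem

lemma ConstCoord.eq_one_of_mem_neutralPt {g : Pt O (ConstCoord O Δ) A} (hg : g ∈ neutralPt A) :
    g = 1 := by
  have apply_ind_one := ConstCoord.apply_ind_one_of_mem_neutralPt hg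
  refine WithConv.ext (ConstCoord.algHom_ext fun δ => ?_)
  have one_apply : (1 : Pt O (ConstCoord O Δ) A).ofConv (ConstCoord.ind O δ) =
      algebraMap O A (ConstCoord.ev O 1 (ConstCoord.ind O δ)) := rfl
  rw [one_apply, ConstCoord.ev_ind]
  obtain rfl | h := eq_or_ne 1 δ
  · rw [apply_ind_one, if_pos rfl, map_one]
  · rw [if_neg h, map_zero, ← one_mul (g.ofConv _), ← apply_ind_one, ← map_mul,
      ConstCoord.ind_mul_ind, if_neg h, map_zero]

lemma ConstCoord.mem_invariants {n : ℕ} (f : Coord O (ConstCoord O Δ) n) :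
    f ∈ invariants O (ConstCoord O Δ) n := by
  intro A _ _ h hh g
  simp [ConstCoord.eq_one_of_mem_neutralPt hh]

lemma ConstCoord.ofRep_injective : Function.Injective
    (PseudoChar.ofRep : (Γ →* Pt O (ConstCoord O Δ) A) → PseudoChar O (ConstCoord O Δ) Γ A) := by
  refine fun σ τ h => MonoidHom.ext fun γ => WithConv.ext (AlgHom.ext fun c => ?_)
  let f : invariants O (ConstCoord O Δ) 1 :=
    ⟨(coordPt (O := O) (H := ConstCoord O Δ) (n := 1) 0).ofConv c, ConstCoord.mem_invariants _⟩
  have evalAt_coord (g : Pt O (ConstCoord O Δ) A) : evalAt (fun _ : Fin 1 => g) f.1 = g.ofConv c :=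
    congrArg (fun x : Pt O (ConstCoord O Δ) A => x.ofConv c) (map_evalAt_coordPt (fun _ => g) 0)
  have evalAt_eq : evalAt (fun _ : Fin 1 => σ γ) f.1 = evalAt (fun _ => τ γ) f.1 :=
    congrArg (fun S : PseudoChar O (ConstCoord O Δ) Γ A => S.Θ 0 f fun _ => γ) h
  rwa [evalAt_coord, evalAt_coord] at evalAt_eq

variable (p : ConstCoord O Δ →ₐc[O] H) (π : Γ →* Δ)

/-- The conditions that a pseudocharacter takes the same values as the pseudocharacter of `π` on
the functions pulled back from the constant group scheme. -/
def admissibleConditions : Set (Condition O H Γ) :=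
  {w | ∃ (n : ℕ) (f : invariants O (ConstCoord O Δ) (n + 1)) (γ : Fin (n + 1) → Γ),
    w = ⟨n, ⟨pullHom p (n + 1) f.1, pullHom_mem p f.2⟩, γ,
      evalAt (fun i => ConstCoord.point O (π (γ i))) f.1⟩}

lemma satisfies_admissibleConditions_iff {S : PseudoChar O H Γ A} :
    S.Satisfies (admissibleConditions p π) ↔ IsAdmissiblePseudoChar p π S := by
  have algebraMap_evalAt {n : ℕ} (γ : Fin n → Γ) (f : Coord O (ConstCoord O Δ) n) :
      algebraMap O A (evalAt (fun i => ConstCoord.point O (π (γ i))) f) =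
        evalAt (fun i => ConstCoord.point A (π (γ i))) f :=
    apply_evalAt (Algebra.ofId O A) _ f
  constructor
  · exact fun h => PseudoChar.ext (funext fun n => AlgHom.ext fun f => funext fun γ =>
      (h _ ⟨n, f, γ, rfl⟩).trans (algebraMap_evalAt γ f.1))
  · rintro h _ ⟨n, f, γ, rfl⟩
    have push_apply := congrArg (fun S : PseudoChar O (ConstCoord O Δ) Γ A => S.Θ n f γ) h
    exact push_apply.trans (algebraMap_evalAt γ f.1).symm

lemma isAdmissiblePseudoChar_ofRep_iff {σ : Γ →* Pt O H A} :
    IsAdmissiblePseudoChar p π (PseudoChar.ofRep σ) ↔ IsAdmissibleRep p π σ := by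
  have push_ofRep : (PseudoChar.ofRep σ).push p = PseudoChar.ofRep ((Pt.push p).comp σ) :=
    PseudoChar.ext (funext fun n => AlgHom.ext fun f => funext fun γ =>
      evalAt_pullHom p f.1 fun i => σ (γ i))
  rw [IsAdmissiblePseudoChar, push_ofRep, ConstCoord.ofRep_injective.eq_iff, IsAdmissibleRep]

lemma isUniversalRepWith_admissibleConditions_iff {ρ : Γ →* Pt O H A} :
    IsUniversalRepWith (admissibleConditions p π) ρ ↔ IsUniversalAdmissibleRep p π ρ := by
  simp only [IsUniversalRepWith, IsUniversalAdmissibleRep, satisfies_admissibleConditions_iff,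
    isAdmissiblePseudoChar_ofRep_iff]

lemma isUniversalPseudoCharWith_admissibleConditions_iff {S : PseudoChar O H Γ A} :
    IsUniversalPseudoCharWith (admissibleConditions p π) S ↔
      IsUniversalAdmissiblePseudoChar p π S := by
  simp only [IsUniversalPseudoCharWith, IsUniversalAdmissiblePseudoChar,
    satisfies_admissibleConditions_iff]

end Admissible

end

end GenTorus

theorem mainTheorem5_general {O H T Γ : Type u} [CommRing O] [CommRing H] [HopfAlgebra O H]
    [CommRing T] [HopfAlgebra O T] [Group Γ] {q : H →ₐc[O] T} (hq : GenTorus.IsOntoNeutral q)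
    {I : T →ₗ[O] O} (hI : GenTorus.IsHaar I) (W : Set (GenTorus.Condition O H Γ)) :
    (∃ (R : Type u) (_ : CommRing R) (_ : Algebra O R) (ρ : Γ →* GenTorus.Pt O H R),
      GenTorus.IsUniversalRepWith W ρ) ∧
    (∃ (P : Type u) (_ : CommRing P) (_ : Algebra O P) (S : GenTorus.PseudoChar O H Γ P),
      GenTorus.IsUniversalPseudoCharWith W S) ∧
    ∀ (R : Type u) [CommRing R] [Algebra O R] (ρ : Γ →* GenTorus.Pt O H R)
      (P : Type u) [CommRing P] [Algebra O P] (S : GenTorus.PseudoChar O H Γ P),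
      GenTorus.IsUniversalRepWith W ρ → GenTorus.IsUniversalPseudoCharWith W S →
      ∃ e : P ≃ₐ[O] GenTorus.repInvariants ρ,
        S.map ((GenTorus.repInvariants ρ).val.comp e.toAlgHom) = GenTorus.PseudoChar.ofRep ρ := by
  have universal_rep := GenTorus.isUniversalRepWith_univRep (W := W)
  refine ⟨⟨_, _, _, _, universal_rep⟩,
    ⟨_, _, _, _, universal_rep.isUniversalPseudoCharWith hq hI⟩, fun R _ _ ρ P _ _ S hρ hS => ?_⟩
  obtain ⟨e, map_e⟩ := hS.exists_algEquiv (hρ.isUniversalPseudoCharWith hq hI)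
  exact ⟨e, congrArg (GenTorus.PseudoChar.map (GenTorus.repInvariants ρ).val) map_e⟩

theorem mainTheorem5 (O H Γ : Type u) [CommRing O] [CommRing H] [HopfAlgebra O H] [Group Γ]
    (hG : GenTorus.IsGeneralisedTorus O H) :
    -- the functors `Rep` and `PC` are representable
    ((∃ (R : Type u) (_ : CommRing R) (_ : Algebra O R) (ρ : Γ →* GenTorus.Pt O H R),
        GenTorus.IsUniversalRep ρ) ∧
      (∃ (P : Type u) (_ : CommRing P) (_ : Algebra O P) (T : GenTorus.PseudoChar O H Γ P),
        GenTorus.IsUniversalPseudoChar T) ∧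
      -- and `ρ ↦ Θ_ρ` induces an isomorphism from `𝒪(PC)` onto `𝒪(Rep)^{G⁰}`
      ∀ (R : Type u) [CommRing R] [Algebra O R] (ρ : Γ →* GenTorus.Pt O H R)
        (P : Type u) [CommRing P] [Algebra O P] (T : GenTorus.PseudoChar O H Γ P),
        GenTorus.IsUniversalRep ρ → GenTorus.IsUniversalPseudoChar T →
        ∃ e : P ≃ₐ[O] GenTorus.repInvariants ρ,
          T.map ((GenTorus.repInvariants ρ).val.comp e.toAlgHom) = GenTorus.PseudoChar.ofRep ρ) ∧
    -- the same for the admissible loci, when `G/G⁰` is the constant group scheme of `Δ`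
    ∀ (Δ : Type u) [Group Δ] [Fintype Δ] [DecidableEq Δ]
      (p : GenTorus.ConstCoord O Δ →ₐc[O] H),
      GenTorus.IsComponentQuotient (p : GenTorus.ConstCoord O Δ →ₐ[O] H) → ∀ π : Γ →* Δ,
      (∃ (R : Type u) (_ : CommRing R) (_ : Algebra O R) (ρ : Γ →* GenTorus.Pt O H R),
        GenTorus.IsUniversalAdmissibleRep p π ρ) ∧
      (∃ (P : Type u) (_ : CommRing P) (_ : Algebra O P) (T : GenTorus.PseudoChar O H Γ P),
        GenTorus.IsUniversalAdmissiblePseudoChar p π T) ∧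
      ∀ (R : Type u) [CommRing R] [Algebra O R] (ρ : Γ →* GenTorus.Pt O H R)
        (P : Type u) [CommRing P] [Algebra O P] (T : GenTorus.PseudoChar O H Γ P),
        GenTorus.IsUniversalAdmissibleRep p π ρ →
        GenTorus.IsUniversalAdmissiblePseudoChar p π T →
        ∃ e : P ≃ₐ[O] GenTorus.repInvariants ρ,
          T.map ((GenTorus.repInvariants ρ).val.comp e.toAlgHom) = GenTorus.PseudoChar.ofRep ρ := by
  obtain ⟨T, _, _, q, hT, hq⟩ := hG.torus
  obtain ⟨I, hI⟩ := hT.exists_isHaar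
  have general := fun W => mainTheorem5_general (Γ := Γ) (fun A _ _ => (hq A).2) hI W
  refine ⟨?_, fun Δ _ _ _ p _ π => ?_⟩
  · simpa only [GenTorus.isUniversalRepWith_empty_iff,
      GenTorus.isUniversalPseudoCharWith_empty_iff] using general ∅
  · simpa only [GenTorus.isUniversalRepWith_admissibleConditions_iff,
      GenTorus.isUniversalPseudoCharWith_admissibleConditions_iff] using
        general (GenTorus.admissibleConditions p π)
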